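/- **Setting.** A spinor is a vector $z=(z^0,z^1)\in\mathbb C^2$, with dual spinor $|z]=(-\bar z^1,\bar z^0)$, $\langle w|z\rangle=\sum_A\bar w^Az^A$, $[w|z\rangle=w^0z^1-w^1z^0$, $\langle w|z]=-\bar w^0\bar z^1+\bar w^1\bar z^0$, and Gaussian measure $\mathrm d\mu(z)=\pi^{-2}e^{-\langle z|z\rangle}\mathrm d^4z$. The boundary of a 3-cell is a closed surface made of finitely many triangles whose sides are glued in pairs (no condition on its topology is needed below). Its dual graph $\Gamma$ is three-valent: nodes $n$ are triangles, links $l$ are edges, half-links are sides of triangles; the links are oriented. For spinors $z_l,\tilde z_l$ at the source and target of every link $l$, the scaleless spin network evaluation is $$\mathcal S^{\rm sl}_\Gamma(\{z_l,\tilde z_l\})=\sum_{\{j_l\}}\mathcal S_{\Gamma,j},\qquad \mathcal S_{\Gamma,j}=\prod_n (J_n+1)!\int_{\mathrm{SU}(2)^{N}}\prod_n\mathrm dh_n\prod_l\frac{1}{(2j_l)!}\,[\tilde z_l|h_{t(l)}^{-1}h_{s(l)}|z_l\rangle^{2j_l},$$ where $j_l$ runs over $\tfrac12\mathbb N$, $\mathrm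 dh$ is the normalized Haar measure, $N$ is the number of nodes, and $J_n$ is the sum of the spins of the three half-links at $n$. **Gluing of Type I.** Let $\triangle_1,\triangle_2$ be 3-cells, $t_1$ a triangle of $\partial\triangle_1$ and $t_2$ a triangle of $\partial\triangle_2$, with their sides identified in pairs. Orient the three links $l_1,l_2,l_3$ at the node $t_1$ to be outgoing (spinors $z_i$ at $t_1$, $\tilde z_i$ at the other end), and the corresponding links $c_1,c_2,c_3$ at the node $t_2$ to be incoming (spinors $\tilde w_i$ at $t_2$, $w_i$ at the other end). The boundary of $\triangle_1\cup\triangle_2$ consists of the remaining triangles, its links being the remaining links and, for $i=1,2,3$, one link from the source of $c_i$ to the target of $l_i$, carrying $w_i$ and $\tilde z_i$. Let $$\mathcal A(z,\tilde w)={}_0F_3\Big(;2,2,\tfrac12;\tfrac14\big(\textstyle\sum_{i=1}^3\langle z_i|\tilde w_i]\big)^2\Big).$$ **Proposition.** Writing $\Gamma_1,\Gamma_2,\Gamma$ for the dual graphs of $\partial\triangle_1,\partial\triangle_2,\partial(\triangle_1\cup\triangle_2)$, $$\mathcal S^{\rm sl}_{\Gamma}=\int\prod_{i=1}^3\mathrm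 d\mu(z_i)\,\mathrm d\mu(\tilde w_i)\;\mathcal S^{\rm sl}_{\Gamma_1}\,\mathcal A(z,\tilde w)\,\mathcal S^{\rm sl}_{\Gamma_2},$$ where the two holomorphic functions $\mathcal S^{\rm sl}_{\Gamma_1},\mathcal S^{\rm sl}_{\Gamma_2}$ are integrated term by term in their expansions. Precisely: 1. The spin sums defining $\mathcal S^{\rm sl}_{\Gamma_1},\mathcal S^{\rm sl}_{\Gamma_2},\mathcal S^{\rm sl}_{\Gamma}$ converge absolutely for all small enough spinors. 2. For all spins $j$ on $\Gamma_1$, $j'$ on $\Gamma_2$ and all spinors on $\Gamma$, the function $\mathcal S_{\Gamma_1,j}\,\mathcal A\,\mathcal S_{\Gamma_2,j'}$ of $(z_i,\tilde w_i)_i$ is integrable. Its integral is $\mathcal S_{\Gamma,j''}$ if $j,j'$ are the spins induced by spins $j''$ on $\Gamma$ (so that $j_{l_i}=j'_{c_i}=j''$ of the $i$-th new link), and it is $0$ if $j_{l_i}\neq j'_{c_i}$ for some $i$. 3. At all spinors on $\Gamma$ where the spin sum of $\mathcal S^{\rm sl}_\Gamma$ converges absolutely, $\mathcal S^{\rm sl}_\Gamma$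 is the unconditional sum over all $(j,j')$ of these integrals. 4. For all small enough spinors on $\Gamma$, the parts of $\mathcal S^{\rm sl}_{\Gamma_1}$ and $\mathcal S^{\rm sl}_{\Gamma_2}$ of given degrees in the integrated spinors $z_1,z_2,z_3$, respectively $\tilde w_1,\tilde w_2,\tilde w_3$, are given by absolutely convergent sums for all values of the integrated spinors; the product of any two such parts with $\mathcal A$ is integrable, and $\mathcal S^{\rm sl}_\Gamma$ is the unconditional sum, over all degrees, of the integrals. -/

import Mathlib

open MeasureTheory

open scoped Nat ComplexConjugate

noncomputable section

/-! ## Spinors -/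

/-- A spinor `|z⟩`, with components `z 0` and `z 1`. -/
abbrev Spinor : Type := Fin 2 → ℂ

/-- The dual spinor `|z] = (-conj z¹, conj z⁰)`. -/
def dualSpinor (z : Spinor) : Spinor := ![-conj (z 1), conj (z 0)]

/-- The Hermitian pairing `⟨w|z⟩`, antilinear in `w`. -/
def bracket (w z : Spinor) : ℂ := ∑ A, conj (w A) * z A

/-- The Gaussian probability measure `dμ(z) = π⁻² e^{-⟨z|z⟩} dz` on `ℂ²`,
where `dz` is Lebesgue measure on `ℂ² = ℝ⁴`. -/
def spinorMeasure : Measure Spinor :=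
  volume.withDensity fun z =>
    ENNReal.ofReal ((Real.pi ^ 2)⁻¹ * Real.exp (-∑ A, ‖z A‖ ^ 2))

/-! ## The group `SU(2)` and its normalized Haar measure -/

/-- The group `SU(2)`. -/
abbrev SU2 : Type := Matrix.specialUnitaryGroup (Fin 2) ℂ

instance : IsTopologicalGroup SU2 where
  continuous_inv := by
    refine Continuous.subtype_mk (f := fun g : SU2 => star (g : Matrix (Fin 2) (Fin 2) ℂ)) ?_ _
    exact continuous_subtype_val.star

instance : CompactSpace SU2 := by
  have hbox : IsCompact (Set.univ.pi fun _ : Fin 2 => Set.univ.pi fun _ : Fin 2 =>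
      Metric.closedBall (0 : ℂ) 1) :=
    isCompact_univ_pi fun _ => isCompact_univ_pi fun _ => isCompact_closedBall _ _
  have hclosed : IsClosed (Matrix.specialUnitaryGroup (Fin 2) ℂ :
      Set (Matrix (Fin 2) (Fin 2) ℂ)) := by
    have : (Matrix.specialUnitaryGroup (Fin 2) ℂ : Set (Matrix (Fin 2) (Fin 2) ℂ)) =
        {A | A * star A = 1} ∩ {A | A.det = 1} := by
      ext A
      simp only [SetLike.mem_coe, Matrix.mem_specialUnitaryGroup_iff,
        Matrix.mem_unitaryGroup_iff, Set.mem_inter_iff, Set.mem_ofPred_eq]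
    rw [this]
    refine IsClosed.inter ?_ ?_
    · exact isClosed_eq (continuous_id.mul continuous_id.star) continuous_const
    · exact isClosed_eq continuous_id.matrix_det continuous_const
  refine isCompact_iff_compactSpace.mp (hbox.of_isClosed_subset hclosed ?_)
  intro A hA i _ j _
  simpa using entry_norm_bound_of_unitary
    (Matrix.specialUnitaryGroup_le_unitaryGroup hA) i j

instance : MeasurableSpace SU2 := borel SU2

instance : BorelSpace SU2 := ⟨rfl⟩

/-- The Haar measure of `SU(2)`, of total mass one. -/
def haarSU2 : Measure SU2 := Measure.haarMeasure ⊤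

/-- The fundamental action `|z⟩ ↦ g|z⟩`. -/
def SU2.act (g : SU2) (z : Spinor) : Spinor := (g : Matrix (Fin 2) (Fin 2) ℂ).mulVec z

/-- The matrix element `[j,w| g |j,z⟩` of `g` between coherent states of spin `j = n / 2`.
The coherent state `|j,z⟩` is the `n`-th tensor power of `|z⟩`, so this is `[w|g|z⟩ⁿ`. -/
def coherentElement (n : ℕ) (w : Spinor) (g : SU2) (z : Spinor) : ℂ :=
  bracket (dualSpinor w) (g.act z) ^ n

/-! ## Triangulated boundaries of 3-cells and their dual graphs -/

/-- A closed triangulated surface, given by a set `T` of triangles, each with three sides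
numbered by `Fin 3`, and a pairing `glue` of the sides. Its dual graph is the three-valent graph
with node set `T`, whose half-links are the sides `T × Fin 3` and whose links are the pairs
`{h, glue h}`, i.e. the edges of the triangulation. The links carry an orientation:
`isSource h` says that the half-link `h` is the source end of its link. -/
structure CellBoundary (T : Type*) where
  /-- The side with which a given side is identified. -/
  glue : T × Fin 3 → T × Fin 3
  glue_glue : ∀ h, glue (glue h) = h
  /-- Whether a half-link is the source end of its link. -/
  isSource : T × Fin 3 → Bool
  isSource_glue : ∀ h, isSource (glue h) = !isSource h

namespace CellBoundary

variable {T : Type*} (C : CellBoundary T)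

/-- The oriented links of the dual graph, each represented by its source end. -/
abbrev Link : Type _ := {h : T × Fin 3 // C.isSource h = true}

/-- The link that contains a given half-link. -/
def link (h : T × Fin 3) : C.Link :=
  if hs : C.isSource h = true then ⟨h, hs⟩
  else ⟨C.glue h, by rw [C.isSource_glue]; simpa using hs⟩

/-- The source end of a link. -/
def src (l : C.Link) : T × Fin 3 := l.1

/-- The target end of a link. -/
def tgt (l : C.Link) : T × Fin 3 := C.glue l.1

variable [Fintype T]

/-- The coherent spin network function of the dual graph, with spin `j_l = n l / 2` and holonomy
`G l` on the link `l`, and with spinor `z h` on the half-link `h`: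
`∫ ∏ₜ dhₜ ∏ₗ [j_l, z_{t(l)}| h_{t(l)}⁻¹ G_l h_{s(l)} |j_l, z_{s(l)}⟩`. -/
def spinNetwork (n : C.Link → ℕ) (z : T × Fin 3 → Spinor) (G : C.Link → SU2) : ℂ :=
  ∫ h : T → SU2, ∏ l : C.Link,
    coherentElement (n l) (z (C.tgt l)) ((h (C.tgt l).1)⁻¹ * G l * h (C.src l).1) (z (C.src l))
    ∂(Measure.pi fun _ : T => haarSU2)

/-- The sum `2 J_t` of `2 j_l` over the three half-links at the node `t`. -/
def nodeDegree (n : C.Link → ℕ) (t : T) : ℕ := ∑ i : Fin 3, n (C.link (t, i))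

/-- The term with spins `j_l = n l / 2` of the scaleless spin network evaluation. If `2 J_t` is odd
at some node then the spin network vanishes, so the rounding in `J_t = nodeDegree n t / 2` is
never seen. -/
def scalelessTerm (n : C.Link → ℕ) (z : T × Fin 3 → Spinor) : ℂ :=
  ((∏ t : T, (C.nodeDegree n t / 2 + 1)! : ℕ) : ℂ) / ((∏ l : C.Link, (n l)! : ℕ) : ℂ) *
    C.spinNetwork n z (fun _ => 1)

/-- The spin sum of the scaleless spin network evaluation converges (absolutely) at `z`. -/
def ConvergesAt (z : T × Fin 3 → Spinor) : Prop :=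
  Summable fun n : C.Link → ℕ => C.scalelessTerm n z

/-- The scaleless spin network evaluation
`∑_{j} ∏ₜ (J_t + 1)! ∏ₗ 1 / (2 j_l)! ∫ ∏ₜ dhₜ ∏ₗ [j_l, z_{t(l)}| h_{t(l)}⁻¹ h_{s(l)} |j_l, z_{s(l)}⟩`
of the dual graph, a function of one spinor per half-link. -/
def scalelessEvaluation (z : T × Fin 3 → Spinor) : ℂ :=
  ∑' n : C.Link → ℕ, C.scalelessTerm n z

/-- The spin sum converges for all small enough spinors. -/
def ConvergesNearZero : Prop :=
  ∃ r : ℝ, 0 < r ∧ ∀ z : T × Fin 3 → Spinor, (∀ h A, ‖z h A‖ < r) → C.ConvergesAt z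

end CellBoundary

/-! ## The edge amplitude -/

/-- The hypergeometric function `₀F₃(; b₁, b₂, b₃; x)`. -/
def hypergeometric0F3 (b₁ b₂ b₃ x : ℂ) : ℂ :=
  ∑' k : ℕ, x ^ k / ((ascPochhammer ℂ k).eval b₁ * (ascPochhammer ℂ k).eval b₂ *
    (ascPochhammer ℂ k).eval b₃ * (k ! : ℂ))

/-- The edge amplitude `₀F₃(; 2, 2, 1/2; (∑ᵢ ⟨z_i|w_{e i}])² / 4)` of two triangles, with
spinors `z` and `w` on their sides, whose sides are identified by `e`. -/
def edgeAmplitude (e : Equiv.Perm (Fin 3)) (z w : Fin 3 → Spinor) : ℂ :=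
  hypergeometric0F3 2 2 (1 / 2) ((∑ i, bracket (z i) (dualSpinor (w (e i)))) ^ 2 / 4)

/-! ## Gluing two 3-cells along a triangle -/

/-- The data of a gluing of type I: a triangle `t₁` of the first boundary and a triangle `t₂` of the
second one, with an identification `sides` of their sides. The three links at the node `t₁` are
outgoing, those at the node `t₂` are incoming. -/
structure TypeIGluing {T₁ T₂ : Type*} (C₁ : CellBoundary T₁) (C₂ : CellBoundary T₂) where
  /-- The triangle of the first cell. -/
  t₁ : T₁
  /-- The triangle of the second cell. -/
  t₂ : T₂
  /-- Side `i` of `t₁` is identified with side `sides i` of `t₂`. -/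
  sides : Equiv.Perm (Fin 3)
  outgoing : ∀ i, C₁.isSource (t₁, i) = true
  incoming : ∀ i, C₂.isSource (t₂, i) = false

namespace TypeIGluing

variable {T₁ T₂ : Type*} {C₁ : CellBoundary T₁} {C₂ : CellBoundary T₂} (G : TypeIGluing C₁ C₂)

/-- The triangles of the boundary of the union: all but the two glued ones. -/
abbrev Triangles : Type _ := {t : T₁ // t ≠ G.t₁} ⊕ {t : T₂ // t ≠ G.t₂}

/-- A side of the first boundary, not on `t₁`, as a side of the boundary of the union. -/
def left (h : T₁ × Fin 3) (hh : h.1 ≠ G.t₁) : G.Triangles × Fin 3 := (Sum.inl ⟨h.1, hh⟩, h.2)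

/-- A side of the second boundary, not on `t₂`, as a side of the boundary of the union. -/
def right (h : T₂ × Fin 3) (hh : h.1 ≠ G.t₂) : G.Triangles × Fin 3 := (Sum.inr ⟨h.1, hh⟩, h.2)

theorem ne_t₁_of_target (h : T₁ × Fin 3) (hs : C₁.isSource h = false) : h.1 ≠ G.t₁ := by
  intro he
  have := G.outgoing h.2
  rw [← he] at this
  simp_all

theorem ne_t₂_of_source (h : T₂ × Fin 3) (hs : C₂.isSource h = true) : h.1 ≠ G.t₂ := by
  intro he
  have := G.incoming h.2
  rw [← he] at this
  simp_all

theorem glue_t₁_ne (i : Fin 3) : (C₁.glue (G.t₁, i)).1 ≠ G.t₁ :=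
  G.ne_t₁_of_target _ (by rw [C₁.isSource_glue, G.outgoing]; rfl)

theorem glue_t₂_ne (i : Fin 3) : (C₂.glue (G.t₂, i)).1 ≠ G.t₂ :=
  G.ne_t₂_of_source _ (by rw [C₂.isSource_glue, G.incoming]; rfl)

theorem tgt_ne (l : C₁.Link) : (C₁.tgt l).1 ≠ G.t₁ :=
  G.ne_t₁_of_target _ (by rw [CellBoundary.tgt, C₁.isSource_glue, l.2]; rfl)

theorem src_ne (l : C₂.Link) : (C₂.src l).1 ≠ G.t₂ :=
  G.ne_t₂_of_source _ l.2

variable [DecidableEq T₁] [DecidableEq T₂]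

/-- The pairing of sides on the boundary of the union. Sides that were paired stay paired, and the
side that was paired with side `i` of `t₁` is now paired with the side that was paired with side
`sides i` of `t₂`. -/
def unionGlue : G.Triangles × Fin 3 → G.Triangles × Fin 3
  | (Sum.inl t, i) =>
    if hh : (C₁.glue (t.1, i)).1 ≠ G.t₁ then G.left (C₁.glue (t.1, i)) hh
    else G.right (C₂.glue (G.t₂, G.sides (C₁.glue (t.1, i)).2)) (G.glue_t₂_ne _)
  | (Sum.inr t, i) =>
    if hh : (C₂.glue (t.1, i)).1 ≠ G.t₂ then G.right (C₂.glue (t.1, i)) hh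
    else G.left (C₁.glue (G.t₁, G.sides.symm (C₂.glue (t.1, i)).2)) (G.glue_t₁_ne _)

/-- The orientation of the links on the boundary of the union, inherited from both parts. -/
def unionIsSource : G.Triangles × Fin 3 → Bool
  | (Sum.inl t, i) => C₁.isSource (t.1, i)
  | (Sum.inr t, i) => C₂.isSource (t.1, i)

/-- The boundary of the union of the two 3-cells. -/
def union : CellBoundary G.Triangles where
  glue := G.unionGlue
  glue_glue := by
    rintro ⟨t | t, i⟩
    · by_cases hh : (C₁.glue (t.1, i)).1 = G.t₁
      · have h1 : C₁.glue (t.1, i) = (G.t₁, (C₁.glue (t.1, i)).2) := Prod.ext hh rfl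
        have h2 : C₁.glue (G.t₁, (C₁.glue (t.1, i)).2) = (t.1, i) := by rw [← h1, C₁.glue_glue]
        simp [unionGlue, hh, right, left, C₂.glue_glue, h2]
      · simp [unionGlue, hh, left, C₁.glue_glue, t.2]
    · by_cases hh : (C₂.glue (t.1, i)).1 = G.t₂
      · have h1 : C₂.glue (t.1, i) = (G.t₂, (C₂.glue (t.1, i)).2) := Prod.ext hh rfl
        have h2 : C₂.glue (G.t₂, (C₂.glue (t.1, i)).2) = (t.1, i) := by rw [← h1, C₂.glue_glue]
        simp [unionGlue, hh, right, left, C₁.glue_glue, h2]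
      · simp [unionGlue, hh, right, C₂.glue_glue, t.2]
  isSource := G.unionIsSource
  isSource_glue := by
    rintro ⟨t | t, i⟩
    · by_cases hh : (C₁.glue (t.1, i)).1 = G.t₁
      · have h1 : C₁.glue (t.1, i) = (G.t₁, (C₁.glue (t.1, i)).2) := Prod.ext hh rfl
        have h2 := C₁.isSource_glue (t.1, i)
        rw [h1, G.outgoing] at h2
        simp [unionGlue, unionIsSource, hh, right, C₂.isSource_glue, G.incoming, ← h2]
      · simp [unionGlue, unionIsSource, hh, left, C₁.isSource_glue]
    · by_cases hh : (C₂.glue (t.1, i)).1 = G.t₂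
      · have h1 : C₂.glue (t.1, i) = (G.t₂, (C₂.glue (t.1, i)).2) := Prod.ext hh rfl
        have h2 := C₂.isSource_glue (t.1, i)
        rw [h1, G.incoming] at h2
        simp [unionGlue, unionIsSource, hh, left, C₁.isSource_glue, G.outgoing, ← h2]
      · simp [unionGlue, unionIsSource, hh, right, C₂.isSource_glue]

/-- The spins on the links of the first boundary that come from spins on the union. -/
def leftSpins (n : G.union.Link → ℕ) (l : C₁.Link) : ℕ :=
  n (G.union.link (G.left (C₁.tgt l) (G.tgt_ne l)))

/-- The spins on the links of the second boundary that come from spins on the union. -/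
def rightSpins (n : G.union.Link → ℕ) (l : C₂.Link) : ℕ :=
  n (G.union.link (G.right (C₂.src l) (G.src_ne l)))

/-- The spinors on the first boundary: `z` on the triangle `t₁`, and `ζ` elsewhere. -/
def leftSpinors (ζ : G.Triangles × Fin 3 → Spinor) (z : Fin 3 → Spinor) (h : T₁ × Fin 3) :
    Spinor :=
  if hh : h.1 ≠ G.t₁ then ζ (G.left h hh) else z h.2

/-- The spinors on the second boundary: `w` on the triangle `t₂`, and `ζ` elsewhere. -/
def rightSpinors (ζ : G.Triangles × Fin 3 → Spinor) (w : Fin 3 → Spinor) (h : T₂ × Fin 3) :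
    Spinor :=
  if hh : h.1 ≠ G.t₂ then ζ (G.right h hh) else w h.2

variable [Fintype T₁] [Fintype T₂]

/-- The integrand of the gluing integral, for the terms with spins `n₁` and `n₂` of the scaleless
spin network evaluations of the two boundaries; `p.1` and `p.2` are the spinors on the two glued
triangles, and `ζ` are those on the boundary of the union. -/
def gluingIntegrand (n₁ : C₁.Link → ℕ) (n₂ : C₂.Link → ℕ) (ζ : G.Triangles × Fin 3 → Spinor)
    (p : (Fin 3 → Spinor) × (Fin 3 → Spinor)) : ℂ :=
  C₁.scalelessTerm n₁ (G.leftSpinors ζ p.1) * edgeAmplitude G.sides p.1 p.2 *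
    C₂.scalelessTerm n₂ (G.rightSpinors ζ p.2)

/-- The part of the scaleless spin network evaluation of the first boundary that is homogeneous of
degree `k i` in the spinor `z i` on side `i` of `t₁`, i.e. the sum over the spins on the other
links. -/
def leftPart (k : Fin 3 → ℕ) (ζ : G.Triangles × Fin 3 → Spinor) (z : Fin 3 → Spinor) : ℂ :=
  ∑' n : {n : C₁.Link → ℕ // ∀ i, n (C₁.link (G.t₁, i)) = k i},
    C₁.scalelessTerm n.1 (G.leftSpinors ζ z)

/-- The part of the scaleless spin network evaluation of the second boundary that is homogeneous of
degree `k i` in the spinor `w i` on side `i` of `t₂`. -/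
def rightPart (k : Fin 3 → ℕ) (ζ : G.Triangles × Fin 3 → Spinor) (w : Fin 3 → Spinor) : ℂ :=
  ∑' n : {n : C₂.Link → ℕ // ∀ i, n (C₂.link (G.t₂, i)) = k i},
    C₂.scalelessTerm n.1 (G.rightSpinors ζ w)

/-- The integrand of the gluing integral, for the homogeneous parts of degrees `k₁` and `k₂` in the
integrated spinors. -/
def partIntegrand (k₁ k₂ : Fin 3 → ℕ) (ζ : G.Triangles × Fin 3 → Spinor)
    (p : (Fin 3 → Spinor) × (Fin 3 → Spinor)) : ℂ :=
  G.leftPart k₁ ζ p.1 * edgeAmplitude G.sides p.1 p.2 * G.rightPart k₂ ζ p.2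

/-- The measure `∏ᵢ dμ(z_i) dμ(w_i)` on the spinors of the two glued triangles. -/
def gluingMeasure : Measure ((Fin 3 → Spinor) × (Fin 3 → Spinor)) :=
  (Measure.pi fun _ => spinorMeasure).prod (Measure.pi fun _ => spinorMeasure)

end TypeIGluing

end

/-!
# Gluing scaleless spin network evaluations along a triangle

The term of the scaleless evaluation with given spins is a weight times a Haar integral of a product
of powers `[z̃|g|z⟩ⁿ`. For a fixed configuration of group elements, the integrand of the first
boundary depends on the spinors `z i` of the glued triangle through `∏ᵢ (aᵢ · zᵢ) ^ kᵢ`, and that of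
the second boundary on the spinors `w i` through `∏ᵢ (bᵢ · wᵢ) ^ lᵢ`, where `aᵢ` and `bᵢ` depend on
the group elements (`networkIntegrand_left`, `networkIntegrand_right`). As `4 ^ m m! (1/2)ₘ = (2 m)!`
and `(2)ₘ = (m + 1)!`, the edge amplitude is `∑ₘ x ^ (2 m) / ((2 m)! (m + 1)!²)` with
`x = ∑ᵢ ⟨zᵢ|wᵢ]` (`hasSum_edgeCoeff_mul_pow`). Up to the factors `(m + 1)!²` this is the even part of
`exp x`, the reproducing kernel of the Gaussian measure, so the Gaussian integral vanishes unless the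
degrees `k` and `l` match, and otherwise it replaces `∏ᵢ (aᵢ · zᵢ) ^ kᵢ ∏ᵢ (bᵢ · wᵢ) ^ kᵢ` by
`∏ᵢ kᵢ! (aᵢ · bᵢ♭) ^ kᵢ / (J + 1)!²`, where `2 J = ∑ᵢ kᵢ` and `bᵢ♭` is the spinor at the far end of
the link with its group elements applied (`integral_prod_mul_edgeAmplitude_mul`). The factor
`1 / (J + 1)!²` cancels the factors `(J + 1)!` of the two triangles that disappear, and `kᵢ!` cancels
one of the two factors `1 / kᵢ!` of the links that are joined (`weight_mul_weight`). In the Haar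
integrals, a gauge transformation on either side absorbs the group elements of these two triangles
(`networkIntegrand_union_gaugeFix`, `measurePreserving_gaugeFix`), and what remains is the integrand
of the union. If `∑ᵢ kᵢ` is odd then the edge amplitude has no term of this degree, and the spin
network of the union vanishes as well, because the sign of the group element of one triangle can be
changed (`integral_networkIntegrand_union_of_odd`).

All convergence statements rest on two bounds. The inequality
`∏ₜ (J_t + 1)! ≤ 2 ^ |T| ∏ₗ 12 ^ nₗ nₗ!` compares the terms of the spin sums with a geometric series
in the norms of the spinors (`norm_scalelessTerm_le`), and the edge amplitude is at most `exp |x|`,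
where `|x|` is at most `1/2 ∑ᵢ (⟨zᵢ|zᵢ⟩ + ⟨wᵢ|wᵢ⟩)`, half of what the Gaussian weight suppresses, so
that all integrands of given degrees are dominated by one integrable function (`gluingBound`).
-/

set_option linter.unusedSectionVars false

noncomputable section

/-! ### Half-links and links -/

namespace CellBoundary

variable {T : Type*} (C : CellBoundary T)

theorem link_of_isSource {h : T × Fin 3} (hs : C.isSource h = true) : C.link h = ⟨h, hs⟩ := by
  simp [link, hs]

theorem link_glue (h : T × Fin 3) : C.link (C.glue h) = C.link h := by
  cases hs : C.isSource h <;> simp [link, hs, C.isSource_glue, C.glue_glue]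

@[simp] theorem link_src (l : C.Link) : C.link (C.src l) = l := C.link_of_isSource l.2

@[simp] theorem link_tgt (l : C.Link) : C.link (C.tgt l) = l := by
  rw [tgt, link_glue]
  exact C.link_of_isSource l.2

theorem isSource_tgt (l : C.Link) : C.isSource (C.tgt l) = false := by
  rw [tgt, C.isSource_glue, l.2]; rfl

/-- The target ends of the links are the half-links that are not source ends. -/
def linkEquivTarget : C.Link ≃ {h : T × Fin 3 // ¬ C.isSource h = true} where
  toFun l := ⟨C.tgt l, by simp [C.isSource_tgt]⟩
  invFun h := ⟨C.glue h.1, by simpa [C.isSource_glue] using h.2⟩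
  left_inv l := by simp [tgt, C.glue_glue]
  right_inv h := by simp [tgt, C.glue_glue]

variable [Fintype T]

theorem prod_halfLink {M : Type*} [CommMonoid M] (f : T × Fin 3 → M) :
    ∏ h, f h = ∏ l : C.Link, f (C.src l) * f (C.tgt l) := by
  rw [← Fintype.prod_subtype_mul_prod_subtype (fun h => C.isSource h = true) f,
    Finset.prod_mul_distrib, ← C.linkEquivTarget.prod_comp]
  rfl

theorem prod_halfLink_link {M : Type*} [CommMonoid M] (f : C.Link → M) :
    ∏ h, f (C.link h) = (∏ l, f l) ^ 2 := by
  simp [C.prod_halfLink, ← sq, Finset.prod_pow]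

end CellBoundary

/-! ### Bounds on the terms of the spin sum -/

theorem factorial_add_le (a b : ℕ) : (a + b)! ≤ 2 ^ (a + b) * (a ! * b !) := by
  rw [← Nat.add_choose_mul_factorial_mul_factorial a b, mul_assoc]
  exact Nat.mul_le_mul_right _ (Nat.choose_le_two_pow _ _)

theorem factorial_sum_three_le (a : Fin 3 → ℕ) :
    (∑ i, a i)! ≤ 4 ^ (∑ i, a i) * ∏ i, (a i)! := by
  simp only [Fin.sum_univ_three, Fin.prod_univ_three]
  calc (a 0 + a 1 + a 2)! ≤ 2 ^ (a 0 + a 1 + a 2) * ((a 0 + a 1)! * (a 2)!) :=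
        factorial_add_le _ _
    _ ≤ 2 ^ (a 0 + a 1 + a 2) * (2 ^ (a 0 + a 1 + a 2) * ((a 0)! * (a 1)!) * (a 2)!) := by
        gcongr
        refine (factorial_add_le _ _).trans ?_
        exact Nat.mul_le_mul_right _ (Nat.pow_le_pow_right two_pos (by omega))
    _ = _ := by
        rw [show (4 : ℕ) = 2 * 2 by norm_num, mul_pow]
        ring

theorem factorial_half_succ_sq_le (m : ℕ) : ((m / 2 + 1)!) ^ 2 ≤ 2 * 3 ^ m * m ! := by
  have h2 : (m + 2) * (m + 1) ≤ 2 * 3 ^ m := by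
    induction m with
    | zero => norm_num
    | succ k ih =>
      rw [pow_succ]
      nlinarith
  have h1 : ((m / 2 + 1)!) ^ 2 ≤ (m + 2)! := by
    rw [sq]
    exact (Nat.le_of_dvd (Nat.factorial_pos _)
      (Nat.factorial_mul_factorial_dvd_factorial_add _ _)).trans (Nat.factorial_le (by omega))
  calc _ ≤ (m + 2)! := h1
    _ = (m + 2) * (m + 1) * m ! := by simp [Nat.factorial_succ, mul_assoc]
    _ ≤ _ := Nat.mul_le_mul_right _ h2

theorem norm_bracket_dualSpinor_le (w z : Spinor) : ‖bracket (dualSpinor w) z‖ ≤ 2 * ‖w‖ * ‖z‖ := by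
  have h : bracket (dualSpinor w) z = -(w 1) * z 0 + w 0 * z 1 := by
    simp [bracket, dualSpinor, Fin.sum_univ_two]
  rw [h]
  calc _ ≤ ‖-(w 1) * z 0‖ + ‖w 0 * z 1‖ := norm_add_le _ _
    _ = ‖w 1‖ * ‖z 0‖ + ‖w 0‖ * ‖z 1‖ := by simp
    _ ≤ ‖w‖ * ‖z‖ + ‖w‖ * ‖z‖ := by gcongr <;> exact norm_le_pi_norm _ _
    _ = _ := by ring

theorem SU2.norm_act_le (g : SU2) (z : Spinor) : ‖g.act z‖ ≤ 2 * ‖z‖ := by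
  have hg : ∀ i j, ‖(g : Matrix (Fin 2) (Fin 2) ℂ) i j‖ ≤ 1 := fun i j =>
    entry_norm_bound_of_unitary (Matrix.specialUnitaryGroup_le_unitaryGroup g.2) i j
  refine (pi_norm_le_iff_of_nonneg (by positivity)).2 fun i => ?_
  simp only [SU2.act, Matrix.mulVec, dotProduct, Fin.sum_univ_two]
  calc _ ≤ ‖(g : Matrix (Fin 2) (Fin 2) ℂ) i 0‖ * ‖z 0‖
        + ‖(g : Matrix (Fin 2) (Fin 2) ℂ) i 1‖ * ‖z 1‖ :=
        (norm_add_le _ _).trans_eq (by simp)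
    _ ≤ 1 * ‖z‖ + 1 * ‖z‖ := by
        gcongr
        exacts [hg _ _, norm_le_pi_norm _ _, hg _ _, norm_le_pi_norm _ _]
    _ = _ := by ring

theorem norm_coherentElement_le (n : ℕ) (w : Spinor) (g : SU2) (z : Spinor) :
    ‖coherentElement n w g z‖ ≤ (2 * ‖w‖) ^ n * (2 * ‖z‖) ^ n := by
  rw [coherentElement, norm_pow, ← mul_pow]
  gcongr
  exact (norm_bracket_dualSpinor_le _ _).trans (by gcongr; exact g.norm_act_le z)

instance : IsProbabilityMeasure haarSU2 := by
  refine ⟨?_⟩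
  simpa [haarSU2] using
    Measure.haarMeasure_self (K₀ := (⊤ : TopologicalSpace.PositiveCompacts SU2))

namespace CellBoundary

variable {T : Type*} (C : CellBoundary T) [Fintype T]

/-- The integrand of the spin network function at trivial link holonomies. -/
def networkIntegrand (n : C.Link → ℕ) (z : T × Fin 3 → Spinor) (h : T → SU2) : ℂ :=
  ∏ l : C.Link, coherentElement (n l) (z (C.tgt l)) ((h (C.tgt l).1)⁻¹ * 1 * h (C.src l).1)
    (z (C.src l))

/-- The factor `∏ₜ (J_t + 1)! ∏ₗ 1 / (2 j_l)!` of the term with spins `j_l = n l / 2`. -/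
def weight (n : C.Link → ℕ) : ℂ :=
  ((∏ t : T, (C.nodeDegree n t / 2 + 1)! : ℕ) : ℂ) / ((∏ l : C.Link, (n l)! : ℕ) : ℂ)

theorem scalelessTerm_eq (n : C.Link → ℕ) (z : T × Fin 3 → Spinor) :
    C.scalelessTerm n z =
      C.weight n * ∫ h, C.networkIntegrand n z h ∂(Measure.pi fun _ : T => haarSU2) := rfl

theorem norm_networkIntegrand_le (n : C.Link → ℕ) (z : T × Fin 3 → Spinor) (h : T → SU2) :
    ‖C.networkIntegrand n z h‖ ≤ ∏ s, (2 * ‖z s‖) ^ n (C.link s) := by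
  rw [networkIntegrand, norm_prod, C.prod_halfLink]
  refine Finset.prod_le_prod (fun _ _ => norm_nonneg _) fun l _ => ?_
  simpa [mul_comm] using norm_coherentElement_le (n l) (z (C.tgt l)) _ (z (C.src l))

/-- The square of `(J + 1)!` is at most `(2 J + 2)!`, which is bounded by the product of the `(2 j)!`
at the node up to exponential factors; every link occurs at two half-links, which undoes the
square. -/
theorem prod_factorial_nodeDegree_le (n : C.Link → ℕ) :
    ∏ t : T, (C.nodeDegree n t / 2 + 1)! ≤
      2 ^ Fintype.card T * ((∏ l, 12 ^ n l) * ∏ l, (n l)!) := by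
  refine (Nat.pow_le_pow_iff_left two_ne_zero).1 ?_
  calc (∏ t : T, (C.nodeDegree n t / 2 + 1)!) ^ 2
      = ∏ t : T, ((C.nodeDegree n t / 2 + 1)!) ^ 2 := by rw [Finset.prod_pow]
    _ ≤ ∏ t : T, 2 * ∏ i, (12 ^ n (C.link (t, i)) * (n (C.link (t, i)))!) := by
        refine Finset.prod_le_prod' fun t _ => ?_
        refine (factorial_half_succ_sq_le _).trans ?_
        rw [mul_assoc, nodeDegree]
        refine Nat.mul_le_mul_left _ ?_
        refine (Nat.mul_le_mul_left _ (factorial_sum_three_le _)).trans_eq ?_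
        rw [Finset.prod_mul_distrib, Finset.prod_pow_eq_pow_sum,
          show (12 : ℕ) = 3 * 4 by norm_num, mul_pow, mul_assoc]
    _ = 2 ^ Fintype.card T * ((∏ l, 12 ^ n l) * ∏ l, (n l)!) ^ 2 := by
        rw [← Finset.prod_mul_distrib, ← C.prod_halfLink_link, Fintype.prod_prod_type,
          Finset.prod_mul_distrib]
        simp
    _ ≤ (2 ^ Fintype.card T * ((∏ l, 12 ^ n l) * ∏ l, (n l)!)) ^ 2 := by
        rw [mul_pow (2 ^ Fintype.card T)]
        exact Nat.mul_le_mul_right _ (Nat.le_self_pow two_ne_zero _)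

theorem norm_weight_le (n : C.Link → ℕ) :
    ‖C.weight n‖ ≤ 2 ^ Fintype.card T * ∏ l, 12 ^ n l := by
  rw [weight, norm_div, Complex.norm_natCast, Complex.norm_natCast]
  have hpos : (0 : ℝ) < ((∏ l : C.Link, (n l)! : ℕ) : ℝ) := by
    exact_mod_cast Finset.prod_pos fun l _ => Nat.factorial_pos _
  rw [div_le_iff₀ hpos, mul_assoc]
  exact_mod_cast C.prod_factorial_nodeDegree_le n

theorem norm_scalelessTerm_le (n : C.Link → ℕ) (z : T × Fin 3 → Spinor) :
    ‖C.scalelessTerm n z‖ ≤ 2 ^ Fintype.card T * ∏ s, (7 * ‖z s‖) ^ n (C.link s) := by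
  have hI : ‖∫ h, C.networkIntegrand n z h ∂(Measure.pi fun _ : T => haarSU2)‖ ≤
      ∏ s, (2 * ‖z s‖) ^ n (C.link s) := by
    simpa using norm_integral_le_of_norm_le_const (μ := Measure.pi fun _ : T => haarSU2)
      (.of_forall (C.norm_networkIntegrand_le n z))
  rw [scalelessTerm_eq, norm_mul]
  calc _ ≤ (2 ^ Fintype.card T * ∏ l, 12 ^ n l) * ∏ s, (2 * ‖z s‖) ^ n (C.link s) :=
        mul_le_mul (C.norm_weight_le n) hI (norm_nonneg _) (by positivity)
    _ = 2 ^ Fintype.card T * ∏ l, 12 ^ n l * ((2 * ‖z (C.src l)‖) * (2 * ‖z (C.tgt l)‖)) ^ n l := by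
        rw [C.prod_halfLink, mul_assoc, ← Finset.prod_mul_distrib]
        simp [mul_pow]
    _ ≤ _ := by
        rw [C.prod_halfLink]
        refine mul_le_mul_of_nonneg_left
          (Finset.prod_le_prod (fun _ _ => by positivity) fun l _ => ?_) (by positivity)
        rw [link_src, link_tgt, ← mul_pow, ← mul_pow]
        refine pow_le_pow_left₀ (by positivity) ?_ _
        nlinarith [mul_nonneg (norm_nonneg (z (C.src l))) (norm_nonneg (z (C.tgt l)))]

/-- The product over all half-links that bounds the terms of the spin sum, with the dependence on the
spinors at one node `t₀` split off. -/
theorem prod_mul_norm_pow_le [DecidableEq T] (n : C.Link → ℕ) (z : T × Fin 3 → Spinor) (t₀ : T)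
    {c r : ℝ} (hc : 0 ≤ c) (hr : 0 < r) (hz : ∀ h, h.1 ≠ t₀ → ‖z h‖ ≤ r) :
    ∏ s, (c * ‖z s‖) ^ n (C.link s) ≤
      ((c * r) ^ 2) ^ (∑ l, n l) * ∏ i, (‖z (t₀, i)‖ / r) ^ n (C.link (t₀, i)) := by
  calc ∏ s, (c * ‖z s‖) ^ n (C.link s)
      ≤ ∏ s, (c * r) ^ n (C.link s) *
          if s.1 = t₀ then (‖z s‖ / r) ^ n (C.link s) else 1 := by
        refine Finset.prod_le_prod (fun _ _ => by positivity) fun s _ => ?_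
        split_ifs with hs
        · rw [← mul_pow]
          apply le_of_eq
          congr 1
          field_simp
        · rw [mul_one]
          gcongr
          exact hz s hs
    _ = _ := by
        rw [Finset.prod_mul_distrib, C.prod_halfLink_link fun l => (c * r) ^ n l,
          Finset.prod_pow_eq_pow_sum, ← pow_mul, ← pow_mul, mul_comm 2, Fintype.prod_prod_type,
          Finset.prod_comm]
        simp

end CellBoundary

theorem summable_pow_sum {ι : Type*} [Fintype ι] {q : ℝ} (hq0 : 0 ≤ q) (hq1 : q < 1) :
    Summable fun n : ι → ℕ => q ^ (∑ i, n i) := by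
  classical
  simp only [← Finset.prod_pow_eq_pow_sum]
  refine summable_of_sum_le (c := ∏ _i : ι, (1 - q)⁻¹) (fun _ => by positivity) fun s => ?_
  let N : ℕ := s.sup fun n => ∑ i, n i
  have hs : s ⊆ Fintype.piFinset fun _ => Finset.range (N + 1) := fun n hn => by
    simp only [Fintype.mem_piFinset, Finset.mem_range]
    intro i
    have h1 : n i ≤ ∑ i, n i := Finset.single_le_sum (fun _ _ => Nat.zero_le _) (Finset.mem_univ i)
    have h2 : ∑ i, n i ≤ N := Finset.le_sup (f := fun n : ι → ℕ => ∑ i, n i) hn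
    omega
  refine (Finset.sum_le_sum_of_subset_of_nonneg hs fun _ _ _ => by positivity).trans ?_
  rw [← Finset.prod_univ_sum (fun _ : ι => Finset.range (N + 1)) fun _ k => q ^ k]
  refine Finset.prod_le_prod (fun _ _ => by positivity) fun _ _ => ?_
  rw [← tsum_geometric_of_lt_one hq0 hq1]
  exact (summable_geometric_of_lt_one hq0 hq1).sum_le_tsum _ fun _ _ => by positivity

theorem CellBoundary.convergesNearZero {T : Type*} [Fintype T] (C : CellBoundary T) :
    C.ConvergesNearZero := by
  -- With norms below `1 / 14`, each link contributes at most `((7 / 14) ^ 2) ^ n = (1 / 4) ^ n`.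
  refine ⟨1 / 14, by norm_num, fun z hz => ?_⟩
  refine .of_norm_bounded (((summable_pow_sum (q := 1 / 4) (by norm_num) (by norm_num)).mul_left
    (2 ^ Fintype.card T))) fun n => (C.norm_scalelessTerm_le n z).trans ?_
  have hz' : ∀ s, ‖z s‖ ≤ 1 / 14 := fun s =>
    (pi_norm_le_iff_of_nonneg (by norm_num)).2 fun A => (hz s A).le
  gcongr
  calc ∏ s, (7 * ‖z s‖) ^ n (C.link s) ≤ ∏ s, (1 / 2 : ℝ) ^ n (C.link s) := by
        refine Finset.prod_le_prod (fun _ _ => by positivity) fun s _ => ?_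
        gcongr
        linarith [hz' s]
    _ = _ := by
        rw [C.prod_halfLink_link fun l => (1 / 2 : ℝ) ^ n l, Finset.prod_pow_eq_pow_sum, ← pow_mul,
          mul_comm, pow_mul]
        norm_num

/-! ### Gaussian integrals over spinors -/

/-- The squared length `⟨z|z⟩`. -/
def Spinor.normSq (z : Spinor) : ℝ := ∑ A, ‖z A‖ ^ 2

theorem Spinor.normSq_nonneg (z : Spinor) : 0 ≤ z.normSq := by
  unfold Spinor.normSq; positivity

theorem continuous_normSq : Continuous Spinor.normSq := by
  unfold Spinor.normSq; fun_prop

theorem continuous_spinorDensity :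
    Continuous fun z : Spinor => (Real.pi ^ 2)⁻¹ * Real.exp (-∑ A, ‖z A‖ ^ 2) := by
  fun_prop

theorem integral_spinorMeasure (f : Spinor → ℂ) :
    ∫ z, f z ∂spinorMeasure =
      ∫ z : Spinor, ((Real.pi ^ 2)⁻¹ * Real.exp (-∑ A, ‖z A‖ ^ 2)) • f z := by
  rw [spinorMeasure, integral_withDensity_eq_integral_toReal_smul
    continuous_spinorDensity.measurable.ennreal_ofReal (by simp)]
  congr 1 with z
  rw [ENNReal.toReal_ofReal (by positivity)]

theorem integrable_spinorMeasure_iff {E : Type*} [NormedAddCommGroup E] [NormedSpace ℝ E]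
    (f : Spinor → E) :
    Integrable f spinorMeasure ↔ Integrable fun z : Spinor =>
      ((Real.pi ^ 2)⁻¹ * Real.exp (-∑ A, ‖z A‖ ^ 2)) • f z := by
  rw [spinorMeasure, integrable_withDensity_iff_integrable_smul'
    continuous_spinorDensity.measurable.ennreal_ofReal (by simp)]
  have : ∀ z : Spinor, (0 : ℝ) ≤ (Real.pi ^ 2)⁻¹ * Real.exp (-∑ A, ‖z A‖ ^ 2) := fun z => by
    positivity
  simp only [ENNReal.toReal_ofReal (this _)]

theorem integrable_exp_neg_mul_norm_sq {b : ℝ} (hb : 0 < b) :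
    Integrable fun z : ℂ => Real.exp (-b * ‖z‖ ^ 2) := by
  have h := (GaussianFourier.integrable_cexp_neg_mul_sq_norm_add (V := ℂ) (b := (b : ℂ))
    (by simpa using hb) 0 0).norm
  refine h.congr (.of_forall fun z => ?_)
  simp only [Complex.norm_exp]
  norm_cast
  simp

theorem integrable_exp_normSq :
    Integrable (fun z : Spinor => Real.exp (3 / 4 * z.normSq)) spinorMeasure := by
  rw [integrable_spinorMeasure_iff]
  have h := (Integrable.fintype_prod (ι := Fin 2) (μ := fun _ => (volume : Measure ℂ))
    (f := fun _ z => Real.exp (-(1 / 4) * ‖z‖ ^ 2)) fun _ =>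
      integrable_exp_neg_mul_norm_sq (by norm_num)).const_mul (Real.pi ^ 2)⁻¹
  refine h.congr (.of_forall fun z => ?_)
  simp only [← Real.exp_sum, smul_eq_mul, mul_assoc, ← Real.exp_add]
  rw [Spinor.normSq, ← Finset.mul_sum]
  ring_nf

instance : IsFiniteMeasure spinorMeasure := by
  have h : Integrable (fun _ : Spinor => (1 : ℝ)) spinorMeasure := by
    refine integrable_exp_normSq.mono' (by fun_prop) (.of_forall fun z => ?_)
    have := z.normSq_nonneg
    simpa using this
  exact (integrable_const_iff_isFiniteMeasure one_ne_zero).1 h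

theorem norm_sq_le_normSq (z : Spinor) : ‖z‖ ^ 2 ≤ z.normSq := by
  have h : ‖z‖ ≤ √z.normSq := (pi_norm_le_iff_of_nonneg (by positivity)).2 fun A => by
    refine Real.le_sqrt_of_sq_le ?_
    exact Finset.single_le_sum (f := fun A => ‖z A‖ ^ 2) (fun _ _ => by positivity)
      (Finset.mem_univ A)
  calc _ ≤ (√z.normSq) ^ 2 := by gcongr
    _ = _ := Real.sq_sqrt z.normSq_nonneg

theorem norm_pow_le_exp_normSq (z : Spinor) (k : ℕ) :
    ‖z‖ ^ k ≤ k ! * Real.exp 1 * Real.exp (1 / 4 * z.normSq) := by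
  have h1 : ‖z‖ ^ k / k ! ≤ Real.exp ‖z‖ := Real.pow_div_factorial_le_exp _ (norm_nonneg _) k
  rw [div_le_iff₀' (by positivity)] at h1
  refine h1.trans ?_
  rw [mul_assoc, ← Real.exp_add]
  gcongr
  nlinarith [norm_sq_le_normSq z, sq_nonneg (‖z‖ - 2)]

theorem integrable_of_norm_le_pow {f : Spinor → ℂ} (hf : Continuous f) (C : ℝ) (m : ℕ)
    (h : ∀ z, ‖f z‖ ≤ C * ‖z‖ ^ m) : Integrable f spinorMeasure := by
  refine (integrable_exp_normSq.const_mul (|C| * (m ! * Real.exp 1))).mono'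
    hf.aestronglyMeasurable (.of_forall fun z => (h z).trans ?_)
  calc C * ‖z‖ ^ m ≤ |C| * (m ! * Real.exp 1 * Real.exp (1 / 4 * z.normSq)) := by
        gcongr
        exacts [le_abs_self C, norm_pow_le_exp_normSq z m]
    _ ≤ |C| * (m ! * Real.exp 1 * Real.exp (3 / 4 * z.normSq)) := by
        gcongr
        · exact z.normSq_nonneg
        · norm_num
    _ = _ := by ring

theorem integral_pow_mul_conj_pow (p q : ℕ) :
    ∫ z : ℂ, Real.exp (-‖z‖ ^ 2) • (z ^ p * conj z ^ q) =
      if p = q then (Real.pi : ℂ) * p ! else 0 := by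
  split_ifs with h
  · subst h
    have h1 := Complex.integral_rpow_mul_exp_neg_mul_rpow (p := 2) (q := 2 * p) (b := 1)
      (by norm_num) (by have : (0 : ℝ) ≤ p := by positivity
                        linarith) one_pos
    have h2 : ∀ z : ℂ, Real.exp (-‖z‖ ^ 2) • (z ^ p * conj z ^ p) =
        ((‖z‖ ^ (2 * p : ℝ) * Real.exp (-1 * ‖z‖ ^ (2 : ℝ)) : ℝ) : ℂ) := fun z => by
      rw [← mul_pow, Complex.mul_conj, Complex.normSq_eq_norm_sq, Real.rpow_mul (norm_nonneg z)]
      norm_cast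
      rw [Complex.real_smul]
      push_cast
      ring_nf
    simp only [h2]
    rw [integral_complex_ofReal, h1, show ((2 * p + 2) / 2 : ℝ) = p + 1 by ring,
      Real.Gamma_nat_eq_factorial]
    simp
  · -- Rotating `z` by a phase `u` multiplies the integral by `u ^ p * conj u ^ q`.
    let I := ∫ z : ℂ, Real.exp (-‖z‖ ^ 2) • (z ^ p * conj z ^ q)
    have hrot : ∀ u : Circle, I = ((u : ℂ) ^ p * conj (u : ℂ) ^ q) * I := fun u => by
      rw [← integral_const_mul]
      refine ((rotation u).measurePreserving.integral_comp
        (rotation u).toHomeomorph.measurableEmbedding _).symm.trans ?_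
      congr 1 with z
      simp only [rotation_apply, norm_mul, Circle.norm_coe, one_mul, map_mul, mul_pow,
        Complex.real_smul]
      ring
    have hpq : (p : ℂ) - q ≠ 0 := sub_ne_zero.2 (by exact_mod_cast h)
    have hu := hrot (Circle.exp (Real.pi / (p - q)))
    rw [← Circle.coe_inv_eq_conj, ← Circle.exp_neg, Circle.coe_exp, Circle.coe_exp,
      ← Complex.exp_nat_mul, ← Complex.exp_nat_mul, ← Complex.exp_add] at hu
    have hexp : (p : ℂ) * (((Real.pi / (p - q) : ℝ) : ℂ) * Complex.I) +
        q * (((-(Real.pi / (p - q)) : ℝ) : ℂ) * Complex.I) = Real.pi * Complex.I := by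
      push_cast
      field_simp
      ring
    rw [hexp, Complex.exp_pi_mul_I] at hu
    rw [neg_one_mul] at hu
    exact self_eq_neg.1 hu

theorem integral_spinorMeasure_prod (f : Fin 2 → ℂ → ℂ) :
    ∫ z, ∏ A, f A (z A) ∂spinorMeasure =
      ∏ A, ((Real.pi : ℂ)⁻¹ * ∫ z : ℂ, Real.exp (-‖z‖ ^ 2) • f A z) := by
  rw [integral_spinorMeasure, Finset.prod_mul_distrib,
    ← integral_fintype_prod_volume_eq_prod fun A z => Real.exp (-‖z‖ ^ 2) • f A z,
    ← integral_const_mul]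
  congr 1 with z
  simp only [Fin.sum_univ_two, Fin.prod_univ_two, Complex.real_smul, neg_add, Real.exp_add]
  push_cast
  ring

theorem norm_dotProduct_le (a z : Spinor) : ‖a ⬝ᵥ z‖ ≤ 2 * ‖a‖ * ‖z‖ := by
  simp only [dotProduct, Fin.sum_univ_two]
  calc _ ≤ ‖a 0‖ * ‖z 0‖ + ‖a 1‖ * ‖z 1‖ := (norm_add_le _ _).trans_eq (by simp)
    _ ≤ ‖a‖ * ‖z‖ + ‖a‖ * ‖z‖ := by gcongr <;> exact norm_le_pi_norm _ _
    _ = _ := by ring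

theorem norm_bracket_le (z c : Spinor) : ‖bracket z c‖ ≤ 2 * ‖z‖ * ‖c‖ := by
  simp only [bracket, Fin.sum_univ_two]
  calc _ ≤ ‖z 0‖ * ‖c 0‖ + ‖z 1‖ * ‖c 1‖ := (norm_add_le _ _).trans_eq (by simp)
    _ ≤ ‖z‖ * ‖c‖ + ‖z‖ * ‖c‖ := by gcongr <;> exact norm_le_pi_norm _ _
    _ = _ := by ring

theorem continuous_bracket : Continuous fun p : Spinor × Spinor => bracket p.1 p.2 := by
  unfold bracket
  fun_prop

theorem integrable_dotProduct_pow_mul_bracket_pow (a c : Spinor) (k l : ℕ) :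
    Integrable (fun z => (a ⬝ᵥ z) ^ k * bracket z c ^ l) spinorMeasure := by
  refine integrable_of_norm_le_pow ?_ ((2 * ‖a‖) ^ k * (2 * ‖c‖) ^ l) (k + l) fun z => ?_
  · unfold bracket dotProduct
    fun_prop
  · rw [norm_mul, norm_pow, norm_pow]
    calc _ ≤ (2 * ‖a‖ * ‖z‖) ^ k * (2 * ‖z‖ * ‖c‖) ^ l := by
          gcongr
          exacts [norm_dotProduct_le a z, norm_bracket_le z c]
      _ = _ := by ring

/-- The Gaussian integral of a product of powers of a linear and an antilinear form. -/
theorem integral_dotProduct_pow_mul_bracket_pow (a c : Spinor) (k l : ℕ) :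
    ∫ z, (a ⬝ᵥ z) ^ k * bracket z c ^ l ∂spinorMeasure =
      if k = l then (k ! : ℂ) * (a ⬝ᵥ c) ^ k else 0 := by
  have hmono : ∀ i j i' j' : ℕ, ∫ z : Spinor, ∏ A,
      (z A) ^ (![i, i'] A) * conj (z A) ^ (![j, j'] A) ∂spinorMeasure =
        if i = j ∧ i' = j' then (i ! * i' ! : ℂ) else 0 := fun i j i' j' => by
    rw [integral_spinorMeasure_prod fun A z => z ^ (![i, i'] A) * conj z ^ (![j, j'] A)]
    simp only [integral_pow_mul_conj_pow, Fin.prod_univ_two, Matrix.cons_val_zero,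
      Matrix.cons_val_one]
    have hpi : (Real.pi : ℂ) ≠ 0 := by exact_mod_cast Real.pi_ne_zero
    by_cases h1 : i = j <;> by_cases h2 : i' = j' <;> simp [h1, h2, hpi]
  have hexp : ∀ z : Spinor, (a ⬝ᵥ z) ^ k * bracket z c ^ l =
      ∑ i ∈ Finset.range (k + 1), ∑ j ∈ Finset.range (l + 1),
        (a 0 ^ i * a 1 ^ (k - i) * k.choose i * (c 0 ^ j * c 1 ^ (l - j) * l.choose j)) *
          ∏ A, (z A) ^ (![i, k - i] A) * conj (z A) ^ (![j, l - j] A) := fun z => by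
    simp only [dotProduct, bracket, Fin.sum_univ_two, add_pow, Finset.sum_mul_sum,
      Fin.prod_univ_two, Matrix.cons_val_zero, Matrix.cons_val_one]
    refine Finset.sum_congr rfl fun i _ => Finset.sum_congr rfl fun j _ => ?_
    ring
  have hint : ∀ i j i' j' : ℕ, Integrable (fun z : Spinor => ∏ A,
      (z A) ^ (![i, i'] A) * conj (z A) ^ (![j, j'] A)) spinorMeasure := fun i j i' j' => by
    refine integrable_of_norm_le_pow (by fun_prop) 1 (i + j + (i' + j')) fun z => ?_
    simp only [Fin.prod_univ_two, Matrix.cons_val_zero, Matrix.cons_val_one, norm_mul, norm_pow,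
      RCLike.norm_conj, ← pow_add, one_mul]
    rw [pow_add ‖z‖]
    gcongr <;> exact norm_le_pi_norm _ _
  simp only [hexp]
  rw [integral_finsetSum _ fun i _ => integrable_finsetSum _ fun j _ => (hint _ _ _ _).const_mul _]
  simp_rw [integral_finsetSum _ fun j _ => (hint _ _ _ _).const_mul _, integral_const_mul, hmono]
  split_ifs with h
  · subst h
    rw [dotProduct, Fin.sum_univ_two, add_pow, Finset.mul_sum]
    refine Finset.sum_congr rfl fun i hi => ?_
    have hik : i ≤ k := Nat.lt_succ_iff.1 (Finset.mem_range.1 hi)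
    rw [Finset.sum_eq_single_of_mem i hi fun j _ hj => by simp [Ne.symm hj]]
    rw [← Nat.choose_mul_factorial_mul_factorial hik]
    push_cast
    simp
    ring
  · refine Finset.sum_eq_zero fun i hi => Finset.sum_eq_zero fun j hj => ?_
    rw [if_neg, mul_zero]
    rw [Finset.mem_range] at hi hj
    omega

/-- Multinomial expansion of `(∑ᵢ ⟨zᵢ|uᵢ⟩)ᴷ` reduces the integral over several spinors to the
integral over one; only the monomial of multidegree `k` survives. -/
theorem integral_prod_dotProduct_pow_mul_sum_bracket_pow {ι : Type*} [Fintype ι] [DecidableEq ι]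
    (a u : ι → Spinor) (k : ι → ℕ) (K : ℕ) :
    ∫ z : ι → Spinor, (∏ i, (a i ⬝ᵥ z i) ^ k i) * (∑ i, bracket (z i) (u i)) ^ K
        ∂(Measure.pi fun _ => spinorMeasure) =
      if ∑ i, k i = K then (K ! : ℂ) * ∏ i, (a i ⬝ᵥ u i) ^ k i else 0 := by
  have hexp : ∀ z : ι → Spinor, (∏ i, (a i ⬝ᵥ z i) ^ k i) * (∑ i, bracket (z i) (u i)) ^ K =
      ∑ l ∈ Finset.piAntidiag Finset.univ K, (Nat.multinomial Finset.univ l : ℂ) *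
        ∏ i, ((a i ⬝ᵥ z i) ^ k i * bracket (z i) (u i) ^ l i) := fun z => by
    rw [Finset.sum_pow_eq_sum_piAntidiag, Finset.mul_sum]
    refine Finset.sum_congr rfl fun l _ => ?_
    rw [Finset.prod_mul_distrib]
    ring
  simp only [hexp]
  rw [integral_finsetSum _ fun l _ => (Integrable.fintype_prod
    (f := fun i z => (a i ⬝ᵥ z) ^ k i * bracket z (u i) ^ l i)
    fun i => integrable_dotProduct_pow_mul_bracket_pow _ _ _ _).const_mul _]
  have hprod : ∀ l : ι → ℕ, ∫ z : ι → Spinor, ∏ i, ((a i ⬝ᵥ z i) ^ k i * bracket (z i) (u i) ^ l i)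
      ∂(Measure.pi fun _ => spinorMeasure) =
        if k = l then ∏ i, ((k i)! : ℂ) * (a i ⬝ᵥ u i) ^ k i else 0 := fun l => by
    rw [integral_fintype_prod_eq_prod fun i z => (a i ⬝ᵥ z) ^ k i * bracket z (u i) ^ l i]
    simp only [integral_dotProduct_pow_mul_bracket_pow, Finset.prod_ite_zero, Finset.mem_univ,
      true_imp_iff, funext_iff]
  simp only [integral_const_mul, hprod, mul_ite, mul_zero, Finset.sum_ite_eq,
    Finset.mem_piAntidiag, Finset.mem_univ, implies_true, and_true]
  split_ifs with h
  · rw [Finset.prod_mul_distrib, ← mul_assoc, ← h, ← Nat.multinomial_spec]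
    push_cast
    ring
  · rfl

/-! ### The edge amplitude as a power series -/

/-- The coefficient of `xᴷ` in the edge amplitude, where `x = ∑ᵢ ⟨z_i|w_i]`. -/
def edgeCoeff (K : ℕ) : ℝ := if Even K then ((K ! : ℝ) * ((K / 2 + 1)! : ℝ) ^ 2)⁻¹ else 0

theorem edgeCoeff_nonneg (K : ℕ) : 0 ≤ edgeCoeff K := by
  unfold edgeCoeff; positivity

theorem edgeCoeff_le (K : ℕ) : edgeCoeff K ≤ (K ! : ℝ)⁻¹ := by
  unfold edgeCoeff
  split_ifs
  · gcongr
    refine le_mul_of_one_le_right (by positivity) (one_le_pow₀ ?_)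
    exact_mod_cast Nat.factorial_pos _
  · positivity

theorem ascPochhammer_eval_two (m : ℕ) : (ascPochhammer ℂ m).eval 2 = ((m + 1)! : ℂ) := by
  induction m with
  | zero => simp
  | succ m ih =>
    rw [ascPochhammer_succ_eval, ih, Nat.factorial_succ (m + 1)]
    push_cast
    ring

theorem four_pow_mul_ascPochhammer_eval_half (m : ℕ) :
    4 ^ m * (ascPochhammer ℂ m).eval (1 / 2) * (m ! : ℂ) = ((2 * m)! : ℂ) := by
  induction m with
  | zero => simp
  | succ m ih =>
    rw [ascPochhammer_succ_eval, show 2 * (m + 1) = 2 * m + 1 + 1 by ring,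
      Nat.factorial_succ (2 * m + 1), Nat.factorial_succ (2 * m), Nat.factorial_succ m]
    push_cast
    rw [← ih]
    ring

theorem norm_edgeCoeff_mul_pow_le (x : ℂ) (K : ℕ) :
    ‖(edgeCoeff K : ℂ) * x ^ K‖ ≤ ‖x‖ ^ K / K ! := by
  rw [norm_mul, norm_pow, Complex.norm_real, Real.norm_of_nonneg (edgeCoeff_nonneg K),
    div_eq_inv_mul]
  gcongr
  exact edgeCoeff_le K

theorem hasSum_edgeCoeff_mul_pow (x : ℂ) :
    HasSum (fun K => (edgeCoeff K : ℂ) * x ^ K) (hypergeometric0F3 2 2 (1 / 2) (x ^ 2 / 4)) := by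
  have hs : Summable fun K => (edgeCoeff K : ℂ) * x ^ K :=
    .of_norm_bounded (Real.summable_pow_div_factorial ‖x‖) (norm_edgeCoeff_mul_pow_le x)
  convert hs.hasSum
  have hsupp : (Function.support fun K => (edgeCoeff K : ℂ) * x ^ K) ⊆
      Set.range fun m : ℕ => 2 * m := fun K hK => by
    by_contra hodd
    refine hK ?_
    have : ¬ Even K := fun ⟨m, hm⟩ => hodd ⟨m, by simp only; omega⟩
    simp [edgeCoeff, this]
  rw [← (mul_right_injective₀ (two_ne_zero (α := ℕ))).tsum_eq hsupp, hypergeometric0F3]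
  congr 1 with m
  have hm : ((2 * m)! : ℂ) ≠ 0 := by exact_mod_cast (Nat.factorial_pos _).ne'
  rw [ascPochhammer_eval_two, edgeCoeff, if_pos (even_two_mul m), Nat.mul_div_cancel_left _ two_pos,
    pow_mul]
  push_cast
  rw [← four_pow_mul_ascPochhammer_eval_half] at hm ⊢
  rw [div_pow, div_div, div_eq_mul_inv, mul_comm]
  congr 2
  ring

theorem norm_hypergeometric0F3_le (x : ℂ) :
    ‖hypergeometric0F3 2 2 (1 / 2) (x ^ 2 / 4)‖ ≤ Real.exp ‖x‖ := by
  rw [← (hasSum_edgeCoeff_mul_pow x).tsum_eq]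
  refine tsum_of_norm_bounded ?_ (norm_edgeCoeff_mul_pow_le x)
  rw [Real.exp_eq_exp_ℝ]
  exact NormedSpace.expSeries_div_hasSum_exp ‖x‖

/-! ### The gluing measure -/

/-- The argument `∑ᵢ ⟨z_i|w_{e i}]` of the edge amplitude. -/
def edgeArgument (e : Equiv.Perm (Fin 3)) (p : (Fin 3 → Spinor) × (Fin 3 → Spinor)) : ℂ :=
  ∑ i, bracket (p.1 i) (dualSpinor (p.2 (e i)))

theorem continuous_dualSpinor : Continuous dualSpinor := by
  unfold dualSpinor
  fun_prop

theorem continuous_edgeArgument (e : Equiv.Perm (Fin 3)) : Continuous (edgeArgument e) := by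
  unfold edgeArgument
  refine continuous_finsetSum _ fun i _ => continuous_bracket.comp (.prodMk (by fun_prop) ?_)
  exact continuous_dualSpinor.comp (by fun_prop)

theorem norm_bracket_dualSpinor_le_normSq (z w : Spinor) :
    ‖bracket z (dualSpinor w)‖ ≤ 1 / 2 * z.normSq + 1 / 2 * w.normSq := by
  simp only [bracket, dualSpinor, Spinor.normSq, Fin.sum_univ_two, Matrix.cons_val_zero,
    Matrix.cons_val_one]
  refine (norm_add_le _ _).trans ?_
  simp only [norm_mul, norm_neg, RCLike.norm_conj]
  nlinarith [sq_nonneg (‖z 0‖ - ‖w 1‖), sq_nonneg (‖z 1‖ - ‖w 0‖)]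

theorem norm_edgeArgument_le (e : Equiv.Perm (Fin 3)) (p : (Fin 3 → Spinor) × (Fin 3 → Spinor)) :
    ‖edgeArgument e p‖ ≤ (∑ i, 1 / 2 * (p.1 i).normSq) + ∑ i, 1 / 2 * (p.2 i).normSq := by
  rw [← Equiv.sum_comp e fun i => 1 / 2 * (p.2 i).normSq, ← Finset.sum_add_distrib]
  exact norm_sum_le_of_le _ fun i _ => norm_bracket_dualSpinor_le_normSq _ _

instance : IsFiniteMeasure TypeIGluing.gluingMeasure := by
  unfold TypeIGluing.gluingMeasure
  infer_instance

/-- The function that dominates the integrands of multidegrees `k` and `l` in the spinors of the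
two glued triangles. -/
def gluingBound (k l : Fin 3 → ℕ) (p : (Fin 3 → Spinor) × (Fin 3 → Spinor)) : ℝ :=
  (∏ i, ‖p.1 i‖ ^ k i * Real.exp (1 / 2 * (p.1 i).normSq)) *
    ∏ i, ‖p.2 i‖ ^ l i * Real.exp (1 / 2 * (p.2 i).normSq)

theorem integrable_norm_pow_mul_exp_normSq (k : ℕ) :
    Integrable (fun z : Spinor => ‖z‖ ^ k * Real.exp (1 / 2 * z.normSq)) spinorMeasure := by
  refine (integrable_exp_normSq.const_mul (k ! * Real.exp 1)).mono'
    (Continuous.aestronglyMeasurable ?_) (.of_forall fun z => ?_)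
  · have := continuous_normSq
    fun_prop
  · rw [Real.norm_of_nonneg (by positivity)]
    calc _ ≤ k ! * Real.exp 1 * Real.exp (1 / 4 * z.normSq) * Real.exp (1 / 2 * z.normSq) := by
          gcongr
          exact norm_pow_le_exp_normSq z k
      _ = _ := by
          rw [mul_assoc, ← Real.exp_add]
          ring_nf

theorem integrable_gluingBound (k l : Fin 3 → ℕ) :
    Integrable (gluingBound k l) TypeIGluing.gluingMeasure := by
  have h : ∀ m : Fin 3 → ℕ, Integrable (fun z : Fin 3 → Spinor =>
      ∏ i, ‖z i‖ ^ m i * Real.exp (1 / 2 * (z i).normSq)) (Measure.pi fun _ => spinorMeasure) :=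
    fun m => Integrable.fintype_prod (μ := fun _ => spinorMeasure)
      (f := fun i (z : Spinor) => ‖z‖ ^ m i * Real.exp (1 / 2 * z.normSq))
      fun i => integrable_norm_pow_mul_exp_normSq (m i)
  exact (h k).mul_prod (h l)

theorem mul_exp_norm_edgeArgument_mul_le (e : Equiv.Perm (Fin 3)) (k l : Fin 3 → ℕ)
    (p : (Fin 3 → Spinor) × (Fin 3 → Spinor)) :
    (∏ i, ‖p.1 i‖ ^ k i) * Real.exp ‖edgeArgument e p‖ * ∏ i, ‖p.2 i‖ ^ l i ≤
      gluingBound k l p := by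
  rw [gluingBound, Finset.prod_mul_distrib, Finset.prod_mul_distrib, ← Real.exp_sum,
    ← Real.exp_sum, mul_mul_mul_comm, ← Real.exp_add, mul_right_comm]
  gcongr
  exact norm_edgeArgument_le e p

theorem stronglyMeasurable_edgeAmplitude (e : Equiv.Perm (Fin 3)) :
    StronglyMeasurable fun p : (Fin 3 → Spinor) × (Fin 3 → Spinor) => edgeAmplitude e p.1 p.2 := by
  refine stronglyMeasurable_of_tendsto Filter.atTop (f := fun (s : Finset ℕ) p =>
    ∑ K ∈ s, (edgeCoeff K : ℂ) * edgeArgument e p ^ K) (fun s => ?_) ?_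
  · have := continuous_edgeArgument e
    exact Continuous.stronglyMeasurable (by fun_prop)
  · exact tendsto_pi_nhds.2 fun p => hasSum_edgeCoeff_mul_pow (edgeArgument e p)

theorem norm_edgeAmplitude_le (e : Equiv.Perm (Fin 3)) (p : (Fin 3 → Spinor) × (Fin 3 → Spinor)) :
    ‖edgeAmplitude e p.1 p.2‖ ≤ Real.exp ‖edgeArgument e p‖ :=
  norm_hypergeometric0F3_le _

theorem norm_mul_edgeAmplitude_mul_le (e : Equiv.Perm (Fin 3)) {k l : Fin 3 → ℕ} {a b : ℂ}
    {A B : ℝ} {p : (Fin 3 → Spinor) × (Fin 3 → Spinor)} (hA : 0 ≤ A) (hB : 0 ≤ B)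
    (ha : ‖a‖ ≤ A * ∏ i, ‖p.1 i‖ ^ k i) (hb : ‖b‖ ≤ B * ∏ i, ‖p.2 i‖ ^ l i) :
    ‖a * edgeAmplitude e p.1 p.2 * b‖ ≤ A * B * gluingBound k l p := by
  rw [norm_mul, norm_mul]
  calc _ ≤ (A * ∏ i, ‖p.1 i‖ ^ k i) * Real.exp ‖edgeArgument e p‖ * (B * ∏ i, ‖p.2 i‖ ^ l i) := by
        gcongr
        exact norm_edgeAmplitude_le e p
    _ = A * B * ((∏ i, ‖p.1 i‖ ^ k i) * Real.exp ‖edgeArgument e p‖ * ∏ i, ‖p.2 i‖ ^ l i) := by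
        ring
    _ ≤ _ := by
        gcongr
        exact mul_exp_norm_edgeArgument_mul_le e k l p

/-- The spinor `c` with `a · |w] = ⟨w|c⟩`. -/
def Spinor.flip (a : Spinor) : Spinor := ![a 1, -a 0]

theorem dotProduct_dualSpinor (a w : Spinor) : a ⬝ᵥ dualSpinor w = bracket w a.flip := by
  simp only [dotProduct, dualSpinor, bracket, Spinor.flip, Fin.sum_univ_two, Matrix.cons_val_zero,
    Matrix.cons_val_one]
  ring

theorem prod_norm_dotProduct_pow_le (a z : Fin 3 → Spinor) (k : Fin 3 → ℕ) :
    ‖∏ i, (a i ⬝ᵥ z i) ^ k i‖ ≤ (∏ i, (2 * ‖a i‖) ^ k i) * ∏ i, ‖z i‖ ^ k i := by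
  rw [norm_prod, ← Finset.prod_mul_distrib]
  refine Finset.prod_le_prod (fun _ _ => norm_nonneg _) fun i _ => ?_
  rw [norm_pow, ← mul_pow]
  gcongr
  exact norm_dotProduct_le _ _

theorem integrable_prod_mul_edgeArgument_pow_mul (e : Equiv.Perm (Fin 3)) (a b : Fin 3 → Spinor)
    (k l : Fin 3 → ℕ) (K : ℕ) :
    Integrable (fun p : (Fin 3 → Spinor) × (Fin 3 → Spinor) =>
      (∏ i, (a i ⬝ᵥ p.1 i) ^ k i) * edgeArgument e p ^ K * ∏ i, (b i ⬝ᵥ p.2 i) ^ l i)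
      TypeIGluing.gluingMeasure := by
  refine ((integrable_gluingBound k l).const_mul
    ((K ! : ℝ) * (∏ i, (2 * ‖a i‖) ^ k i) * ∏ i, (2 * ‖b i‖) ^ l i)).mono'
    (Continuous.aestronglyMeasurable ?_) (.of_forall fun p => ?_)
  · have := continuous_edgeArgument e
    unfold dotProduct
    fun_prop
  · rw [norm_mul, norm_mul, norm_pow]
    have hK : ‖edgeArgument e p‖ ^ K ≤ K ! * Real.exp ‖edgeArgument e p‖ := by
      rw [← div_le_iff₀' (by positivity)]
      exact Real.pow_div_factorial_le_exp _ (norm_nonneg _) K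
    calc _ ≤ ((∏ i, (2 * ‖a i‖) ^ k i) * ∏ i, ‖p.1 i‖ ^ k i) *
          (K ! * Real.exp ‖edgeArgument e p‖) *
          ((∏ i, (2 * ‖b i‖) ^ l i) * ∏ i, ‖p.2 i‖ ^ l i) := by
          gcongr
          exacts [prod_norm_dotProduct_pow_le _ _ _, prod_norm_dotProduct_pow_le _ _ _]
      _ = (K ! : ℝ) * (∏ i, (2 * ‖a i‖) ^ k i) * (∏ i, (2 * ‖b i‖) ^ l i) *
          ((∏ i, ‖p.1 i‖ ^ k i) * Real.exp ‖edgeArgument e p‖ * ∏ i, ‖p.2 i‖ ^ l i) := by ring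
      _ ≤ _ := by
          gcongr
          exact mul_exp_norm_edgeArgument_mul_le e k l p

theorem integral_prod_mul_edgeArgument_pow_mul (e : Equiv.Perm (Fin 3)) (a b : Fin 3 → Spinor)
    (k l : Fin 3 → ℕ) (K : ℕ) :
    ∫ p, (∏ i, (a i ⬝ᵥ p.1 i) ^ k i) * edgeArgument e p ^ K * ∏ i, (b i ⬝ᵥ p.2 i) ^ l i
        ∂TypeIGluing.gluingMeasure =
      if ∑ i, k i = K then
        (K ! : ℂ) * ∏ i, if l (e i) = k i then ((k i)! : ℂ) * (b (e i) ⬝ᵥ (a i).flip) ^ k i else 0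
      else 0 := by
  have hint := integrable_prod_mul_edgeArgument_pow_mul e a b k l K
  rw [TypeIGluing.gluingMeasure] at hint ⊢
  rw [integral_prod_symm _ hint]
  simp only [edgeArgument, integral_mul_const, integral_prod_dotProduct_pow_mul_sum_bracket_pow]
  split_ifs with h
  · have hre : ∀ w : Fin 3 → Spinor,
        (K ! : ℂ) * (∏ i, (a i ⬝ᵥ dualSpinor (w (e i))) ^ k i) * ∏ i, (b i ⬝ᵥ w i) ^ l i =
        (K ! : ℂ) * ∏ i, (b i ⬝ᵥ w i) ^ l i *
          bracket (w i) (a (e.symm i)).flip ^ k (e.symm i) := fun w => by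
      rw [Finset.prod_mul_distrib, ← Equiv.prod_comp e fun i =>
        bracket (w i) (a (e.symm i)).flip ^ k (e.symm i)]
      simp only [Equiv.symm_apply_apply, dotProduct_dualSpinor]
      ring
    simp only [hre, integral_const_mul]
    rw [integral_fintype_prod_eq_prod fun i w => (b i ⬝ᵥ w) ^ l i *
          bracket w (a (e.symm i)).flip ^ k (e.symm i)]
    simp only [integral_dotProduct_pow_mul_bracket_pow]
    rw [← Equiv.prod_comp e]
    simp only [Equiv.symm_apply_apply]
    congr 1
    refine Finset.prod_congr rfl fun i _ => ?_
    split_ifs with hi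
    · rw [hi]
    · rfl
  · simp

/-- Integration of the edge amplitude against products of powers of linear forms. The factor
`(J + 1)!²`, with `2J = ∑ᵢ k i`, in the denominator comes from the coefficient of the edge
amplitude. -/
theorem integral_prod_mul_edgeAmplitude_mul (e : Equiv.Perm (Fin 3)) (a b : Fin 3 → Spinor)
    (k l : Fin 3 → ℕ) :
    ∫ p, (∏ i, (a i ⬝ᵥ p.1 i) ^ k i) * edgeAmplitude e p.1 p.2 * ∏ i, (b i ⬝ᵥ p.2 i) ^ l i
        ∂TypeIGluing.gluingMeasure =
      (edgeCoeff (∑ i, k i) : ℂ) * ((∑ i, k i)! : ℂ) *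
        ∏ i, if l (e i) = k i then ((k i)! : ℂ) * (b (e i) ⬝ᵥ (a i).flip) ^ k i else 0 := by
  let F : ℕ → (Fin 3 → Spinor) × (Fin 3 → Spinor) → ℂ := fun K p => (edgeCoeff K : ℂ) *
    ((∏ i, (a i ⬝ᵥ p.1 i) ^ k i) * edgeArgument e p ^ K * ∏ i, (b i ⬝ᵥ p.2 i) ^ l i)
  let c : ℝ := (∏ i, (2 * ‖a i‖) ^ k i) * ∏ i, (2 * ‖b i‖) ^ l i
  let g : (Fin 3 → Spinor) × (Fin 3 → Spinor) → ℝ := fun p =>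
    c * ((∏ i, ‖p.1 i‖ ^ k i) * ∏ i, ‖p.2 i‖ ^ l i)
  have hexp : ∀ p, HasSum (fun K : ℕ => ‖edgeArgument e p‖ ^ K / K !)
      (Real.exp ‖edgeArgument e p‖) := fun p => by
    rw [Real.exp_eq_exp_ℝ]
    exact NormedSpace.expSeries_div_hasSum_exp _
  have hsum := hasSum_integral_of_dominated_convergence (F := F)
    (f := fun p => (∏ i, (a i ⬝ᵥ p.1 i) ^ k i) * edgeAmplitude e p.1 p.2 *
      ∏ i, (b i ⬝ᵥ p.2 i) ^ l i) (μ := TypeIGluing.gluingMeasure)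
    (fun K p => g p * (‖edgeArgument e p‖ ^ K / K !))
    (fun K => ((integrable_prod_mul_edgeArgument_pow_mul e a b k l K).const_mul _).1)
    (fun K => .of_forall fun p => ?_) (.of_forall fun p => (hexp p).summable.mul_left _) ?_
    (.of_forall fun p => ?_)
  · refine hsum.unique ?_
    have hF : ∀ K, ∫ p, F K p ∂TypeIGluing.gluingMeasure =
        if K = ∑ i, k i then (edgeCoeff (∑ i, k i) : ℂ) * ((∑ i, k i)! : ℂ) *
          ∏ i, (if l (e i) = k i then ((k i)! : ℂ) * (b (e i) ⬝ᵥ (a i).flip) ^ k i else 0)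
        else 0 := fun K => by
      simp only [F]
      rw [integral_const_mul, integral_prod_mul_edgeArgument_pow_mul]
      by_cases hK : K = ∑ i, k i
      · simp only [hK, if_true, mul_assoc]
      · simp [hK, Ne.symm hK]
    simp only [hF]
    exact hasSum_ite_eq _ _
  · simp only [F, g, c]
    calc _ = ‖∏ i, (a i ⬝ᵥ p.1 i) ^ k i‖ * ‖∏ i, (b i ⬝ᵥ p.2 i) ^ l i‖ *
          ‖(edgeCoeff K : ℂ) * edgeArgument e p ^ K‖ := by
          simp only [norm_mul]
          ring
      _ ≤ ((∏ i, (2 * ‖a i‖) ^ k i) * ∏ i, ‖p.1 i‖ ^ k i) *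
          ((∏ i, (2 * ‖b i‖) ^ l i) * ∏ i, ‖p.2 i‖ ^ l i) * (‖edgeArgument e p‖ ^ K / K !) := by
          gcongr
          exacts [prod_norm_dotProduct_pow_le _ _ _, prod_norm_dotProduct_pow_le _ _ _,
            norm_edgeCoeff_mul_pow_le _ _]
      _ = _ := by ring
  · simp only [fun p => ((hexp p).mul_left (g p)).tsum_eq]
    refine ((integrable_gluingBound k l).const_mul c).mono'
      (Continuous.aestronglyMeasurable ?_) (.of_forall fun p => ?_)
    · have := continuous_edgeArgument e
      fun_prop
    · rw [Real.norm_of_nonneg (by positivity)]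
      calc _ = c * ((∏ i, ‖p.1 i‖ ^ k i) * Real.exp ‖edgeArgument e p‖ * ∏ i, ‖p.2 i‖ ^ l i) := by
            simp only [g]; ring
        _ ≤ _ := by
            gcongr
            exact mul_exp_norm_edgeArgument_mul_le e k l p
  · have h := ((hasSum_edgeCoeff_mul_pow (edgeArgument e p)).mul_left
      (∏ i, (a i ⬝ᵥ p.1 i) ^ k i)).mul_right (∏ i, (b i ⬝ᵥ p.2 i) ^ l i)
    refine h.congr_fun fun K => ?_
    simp only [F]
    ring

/-! ### Integration over the gauge group -/

instance : SecondCountableTopology SU2 :=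
  inferInstanceAs (SecondCountableTopology
    {A : Fin 2 → Fin 2 → ℂ // A ∈ Matrix.specialUnitaryGroup (Fin 2) ℂ})

instance : haarSU2.IsMulLeftInvariant := by
  unfold haarSU2
  infer_instance

/-- The Haar measure on the product of one copy of `SU(2)` for every node. -/
abbrev gaugeMeasure (T : Type*) [Fintype T] : Measure (T → SU2) := Measure.pi fun _ => haarSU2

theorem measurePreserving_inv_mul {ι κ : Type*} [Fintype ι] [Fintype κ] (i : ι) :
    MeasurePreserving (fun (p : (ι → SU2) × (κ → SU2)) (t : κ) => (p.1 i)⁻¹ * p.2 t)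
      ((gaugeMeasure ι).prod (gaugeMeasure κ)) (gaugeMeasure κ) := by
  let g : (ι → SU2) → (κ → SU2) → κ → SU2 := fun p q => (fun _ => (p i)⁻¹) * q
  have hg : Continuous (Function.uncurry g) := by
    refine continuous_pi fun t => ?_
    change Continuous fun x : (ι → SU2) × (κ → SU2) => (x.1 i)⁻¹ * x.2 t
    fun_prop
  exact measurePreserving_snd.comp ((MeasurePreserving.id (gaugeMeasure ι)).skew_product (g := g)
    hg.measurable (.of_forall fun p => map_mul_left_eq_self (gaugeMeasure κ) _))

/-- Moving the group element of one node to the identity by a gauge transformation, and dropping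
it, preserves the Haar measure. -/
theorem measurePreserving_gaugeFix {T : Type*} [Fintype T] [DecidableEq T] (t₀ : T) :
    MeasurePreserving (fun (h : T → SU2) (t : {t // t ≠ t₀}) => (h t₀)⁻¹ * h t.1)
      (gaugeMeasure T) (gaugeMeasure {t // t ≠ t₀}) :=
  -- The singleton `{t // t = t₀}` has two `Fintype` instances; the equivalence needs this one.
  letI : Fintype {t // t = t₀} := Subtype.fintype _
  have hsplit := measurePreserving_piEquivPiSubtypeProd (fun _ : T => haarSU2) (fun t => t = t₀)
  have hfix := measurePreserving_inv_mul (ι := {t // t = t₀}) (κ := {t // t ≠ t₀}) ⟨t₀, rfl⟩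
  have hcomp := MeasurePreserving.comp hfix hsplit
  hcomp

theorem continuous_coherentElement (n : ℕ) :
    Continuous fun p : Spinor × SU2 × Spinor => coherentElement n p.1 p.2.1 p.2.2 := by
  have h : Continuous fun p : Spinor × SU2 × Spinor => p.2.1.act p.2.2 :=
    (continuous_subtype_val.comp (by fun_prop : Continuous fun p : Spinor × SU2 × Spinor =>
      p.2.1)).matrix_mulVec (by fun_prop)
  exact (continuous_bracket.comp (.prodMk (continuous_dualSpinor.comp continuous_fst) h)).pow n

theorem CellBoundary.continuous_networkIntegrand {T : Type*} (C : CellBoundary T) [Fintype T]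
    (n : C.Link → ℕ) : Continuous fun p : (T × Fin 3 → Spinor) × (T → SU2) =>
      C.networkIntegrand n p.1 p.2 := by
  unfold networkIntegrand
  exact continuous_finsetProd _ fun l _ => (continuous_coherentElement (n l)).comp
    (f := fun p : (T × Fin 3 → Spinor) × (T → SU2) =>
      (p.1 (C.tgt l), (p.2 (C.tgt l).1)⁻¹ * 1 * p.2 (C.src l).1, p.1 (C.src l))) (by fun_prop)

/-- The linear form `[w|g|·⟩`. -/
def SU2.rowForm (w : Spinor) (g : SU2) : Spinor :=
  Matrix.vecMul ![-w 1, w 0] (g : Matrix (Fin 2) (Fin 2) ℂ)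

theorem coherentElement_eq_rowForm (n : ℕ) (w : Spinor) (g : SU2) (z : Spinor) :
    coherentElement n w g z = (SU2.rowForm w g ⬝ᵥ z) ^ n := by
  rw [coherentElement, SU2.rowForm, ← Matrix.dotProduct_mulVec, SU2.act]
  simp [bracket, dualSpinor, dotProduct, Fin.sum_univ_two]

theorem coherentElement_eq_flip (n : ℕ) (w : Spinor) (g : SU2) (z : Spinor) :
    coherentElement n w g z = ((g.act z).flip ⬝ᵥ w) ^ n := by
  rw [coherentElement]
  congr 1
  simp only [bracket, dualSpinor, dotProduct, Spinor.flip, Fin.sum_univ_two, Matrix.cons_val_zero,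
    Matrix.cons_val_one, map_neg, Complex.conj_conj]
  ring

theorem flip_dotProduct_flip (a b : Spinor) : a.flip ⬝ᵥ b.flip = b ⬝ᵥ a := by
  simp only [dotProduct, Spinor.flip, Fin.sum_univ_two, Matrix.cons_val_zero, Matrix.cons_val_one]
  ring

theorem SU2.rowForm_dotProduct_act (w : Spinor) (g g' : SU2) (z : Spinor) :
    SU2.rowForm w g ⬝ᵥ g'.act z = SU2.rowForm w (g * g') ⬝ᵥ z := by
  simp only [SU2.rowForm, SU2.act, Matrix.dotProduct_mulVec, Submonoid.coe_mul,
    Matrix.vecMul_vecMul]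

/-- The central element `-1` of `SU(2)`. -/
def SU2.negOne : SU2 := ⟨-1, by
  rw [Matrix.mem_specialUnitaryGroup_iff, Matrix.mem_unitaryGroup_iff]
  exact ⟨by simp, by simp [Matrix.det_neg]⟩⟩

theorem SU2.rowForm_mul_negOne_mul (w : Spinor) (g g' : SU2) :
    SU2.rowForm w (g * (SU2.negOne * g')) = -SU2.rowForm w (g * g') := by
  simp [SU2.rowForm, SU2.negOne, Matrix.vecMul_neg]

/-! ### The links of the glued boundary -/

namespace TypeIGluing

variable {T₁ T₂ : Type*} {C₁ : CellBoundary T₁} {C₂ : CellBoundary T₂} (G : TypeIGluing C₁ C₂)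

/-- The outgoing link at side `i` of the first glued triangle. -/
def outLink (i : Fin 3) : C₁.Link := ⟨(G.t₁, i), G.outgoing i⟩

/-- The incoming link at side `i` of the second glued triangle. -/
def inLink (i : Fin 3) : C₂.Link :=
  ⟨C₂.glue (G.t₂, i), by rw [C₂.isSource_glue, G.incoming]; rfl⟩

theorem link_t₁ (i : Fin 3) : C₁.link (G.t₁, i) = G.outLink i := C₁.link_of_isSource _

theorem tgt_inLink (i : Fin 3) : C₂.tgt (G.inLink i) = (G.t₂, i) := C₂.glue_glue _

theorem link_t₂ (i : Fin 3) : C₂.link (G.t₂, i) = G.inLink i := by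
  rw [← G.tgt_inLink i, C₂.link_tgt]

/-- The links of the first boundary away from the glued triangle. -/
abbrev LeftLink : Type _ := {l : C₁.Link // (C₁.src l).1 ≠ G.t₁}

/-- The links of the second boundary away from the glued triangle. -/
abbrev RightLink : Type _ := {l : C₂.Link // (C₂.tgt l).1 ≠ G.t₂}

theorem eq_outLink (l : C₁.Link) (h : (C₁.src l).1 = G.t₁) : l = G.outLink (C₁.src l).2 :=
  Subtype.ext (Prod.ext h rfl)

theorem eq_inLink (l : C₂.Link) (h : (C₂.tgt l).1 = G.t₂) : l = G.inLink (C₂.tgt l).2 := by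
  rw [← G.link_t₂, show (G.t₂, (C₂.tgt l).2) = C₂.tgt l from Prod.ext h.symm rfl, C₂.link_tgt]

theorem prod_link_left [DecidableEq T₁] [Fintype T₁] {M : Type*} [CommMonoid M] (f : C₁.Link → M) :
    ∏ l, f l = (∏ i, f (G.outLink i)) * ∏ l : G.LeftLink, f l := by
  rw [← Fintype.prod_subtype_mul_prod_subtype (fun l : C₁.Link => (C₁.src l).1 = G.t₁) f]
  congr 1
  let e : Fin 3 ≃ {l : C₁.Link // (C₁.src l).1 = G.t₁} :=
    { toFun := fun i => ⟨G.outLink i, rfl⟩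
      invFun := fun l => (C₁.src l.1).2
      left_inv := fun i => rfl
      right_inv := fun l => Subtype.ext (G.eq_outLink l.1 l.2).symm }
  exact (e.prod_comp fun l => f l).symm

theorem prod_link_right [DecidableEq T₂] [Fintype T₂] {M : Type*} [CommMonoid M] (f : C₂.Link → M) :
    ∏ l, f l = (∏ i, f (G.inLink i)) * ∏ l : G.RightLink, f l := by
  rw [← Fintype.prod_subtype_mul_prod_subtype (fun l : C₂.Link => (C₂.tgt l).1 = G.t₂) f]
  congr 1
  let e : Fin 3 ≃ {l : C₂.Link // (C₂.tgt l).1 = G.t₂} :=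
    { toFun := fun i => ⟨G.inLink i, congrArg Prod.fst (G.tgt_inLink i)⟩
      invFun := fun l => (C₂.tgt l.1).2
      left_inv := fun i => congrArg Prod.snd (G.tgt_inLink i)
      right_inv := fun l => Subtype.ext (G.eq_inLink l.1 l.2).symm }
  exact (e.prod_comp fun l => f l).symm

variable [DecidableEq T₁] [DecidableEq T₂]

/-- A link of the first boundary away from the glued triangle, as a link of the union. -/
def ofLeft (l : G.LeftLink) : G.union.Link := ⟨G.left (C₁.src l.1) l.2, l.1.2⟩

/-- A link of the second boundary as a link of the union. The links at the glued triangle become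
the new links that join the two parts. -/
def ofRight (l : C₂.Link) : G.union.Link := ⟨G.right (C₂.src l) (G.src_ne l), l.2⟩

/-- The links of the union are the links of the second boundary and those of the first one that are
away from the glued triangle. -/
def linkEquiv : G.LeftLink ⊕ C₂.Link ≃ G.union.Link where
  toFun := Sum.elim G.ofLeft G.ofRight
  invFun
    | ⟨(Sum.inl t, i), h⟩ => Sum.inl ⟨⟨(t.1, i), h⟩, t.2⟩
    | ⟨(Sum.inr t, i), h⟩ => Sum.inr ⟨(t.1, i), h⟩
  left_inv := by rintro (l | l) <;> rfl
  right_inv := by rintro ⟨⟨t | t, i⟩, h⟩ <;> rfl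

theorem prod_link_union [Fintype T₁] [Fintype T₂] {M : Type*} [CommMonoid M]
    (f : G.union.Link → M) : ∏ l, f l = (∏ l, f (G.ofLeft l)) * ∏ l, f (G.ofRight l) := by
  rw [← G.linkEquiv.prod_comp, Fintype.prod_sum_type]
  rfl

theorem tgt_ofLeft (l : G.LeftLink) : G.union.tgt (G.ofLeft l) = G.left (C₁.tgt l.1) (G.tgt_ne _) :=
  dif_pos (G.tgt_ne l.1)

theorem tgt_ofRight (l : G.RightLink) : G.union.tgt (G.ofRight l) = G.right (C₂.tgt l.1) l.2 :=
  dif_pos l.2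

theorem tgt_ofRight_inLink (i : Fin 3) : G.union.tgt (G.ofRight (G.inLink (G.sides i))) =
    G.left (C₁.tgt (G.outLink i)) (G.tgt_ne _) := by
  have h := G.tgt_inLink (G.sides i)
  refine (dif_neg ?_).trans ?_
  · exact not_not.2 (congrArg Prod.fst h)
  · have h2 : G.sides.symm (C₂.tgt (G.inLink (G.sides i))).2 = i := by rw [h]; simp
    change G.left (C₁.glue (G.t₁, G.sides.symm (C₂.tgt (G.inLink (G.sides i))).2)) _ = _
    simp only [h2]
    rfl

theorem leftSpins_of_ne (n : G.union.Link → ℕ) (l : G.LeftLink) :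
    G.leftSpins n l.1 = n (G.ofLeft l) := by
  rw [leftSpins, ← tgt_ofLeft, CellBoundary.link_tgt]

theorem rightSpins_eq (n : G.union.Link → ℕ) (l : C₂.Link) : G.rightSpins n l = n (G.ofRight l) :=
  congrArg n (G.union.link_src (G.ofRight l))

theorem leftSpins_outLink (n : G.union.Link → ℕ) (i : Fin 3) :
    G.leftSpins n (G.outLink i) = n (G.ofRight (G.inLink (G.sides i))) := by
  rw [leftSpins, ← tgt_ofRight_inLink, CellBoundary.link_tgt]

theorem rightSpins_link_t₂ (n : G.union.Link → ℕ) (i : Fin 3) :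
    G.rightSpins n (C₂.link (G.t₂, G.sides i)) = G.leftSpins n (C₁.link (G.t₁, i)) := by
  rw [link_t₁, link_t₂, leftSpins_outLink, rightSpins_eq]

theorem leftSpins_link (n : G.union.Link → ℕ) (t : {t // t ≠ G.t₁}) (i : Fin 3) :
    G.leftSpins n (C₁.link (t.1, i)) = n (G.union.link (Sum.inl t, i)) := by
  cases hs : C₁.isSource (t.1, i)
  · have h : C₁.tgt (C₁.link (t.1, i)) = (t.1, i) := by
      simp [CellBoundary.link, CellBoundary.tgt, hs, C₁.glue_glue]
    simp only [leftSpins, h]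
    rfl
  · have h := C₁.link_of_isSource hs
    refine (congrArg _ h).trans ((G.leftSpins_of_ne n ⟨⟨(t.1, i), hs⟩, t.2⟩).trans ?_)
    exact congrArg n (G.union.link_of_isSource (h := (Sum.inl t, i)) hs).symm

theorem rightSpins_link (n : G.union.Link → ℕ) (t : {t // t ≠ G.t₂}) (i : Fin 3) :
    G.rightSpins n (C₂.link (t.1, i)) = n (G.union.link (Sum.inr t, i)) := by
  cases hs : C₂.isSource (t.1, i)
  · have h : C₂.tgt (C₂.link (t.1, i)) = (t.1, i) := by
      simp [CellBoundary.link, CellBoundary.tgt, hs, C₂.glue_glue]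
    have h' := G.tgt_ofRight ⟨C₂.link (t.1, i), by rw [h]; exact t.2⟩
    rw [rightSpins_eq, ← G.union.link_tgt (G.ofRight _), h']
    simp only [h]
    rfl
  · rw [C₂.link_of_isSource hs, rightSpins_eq, ← G.union.link_src (G.ofRight _)]
    rfl

theorem injective_leftSpins_rightSpins :
    Function.Injective fun n : G.union.Link → ℕ => (G.leftSpins n, G.rightSpins n) := by
  intro n n' h
  rw [Prod.mk.injEq] at h
  funext l
  obtain ⟨l | l, rfl⟩ := G.linkEquiv.surjective l
  · exact (G.leftSpins_of_ne n l).symm.trans ((congrFun h.1 l.1).trans (G.leftSpins_of_ne n' l))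
  · exact (G.rightSpins_eq n l).symm.trans ((congrFun h.2 l).trans (G.rightSpins_eq n' l))

theorem exists_leftSpins_rightSpins {n₁ : C₁.Link → ℕ} {n₂ : C₂.Link → ℕ}
    (h : ∀ i, n₁ (C₁.link (G.t₁, i)) = n₂ (C₂.link (G.t₂, G.sides i))) :
    ∃ n, G.leftSpins n = n₁ ∧ G.rightSpins n = n₂ := by
  let n : G.union.Link → ℕ := fun l => Sum.elim (fun l : G.LeftLink => n₁ l) n₂ (G.linkEquiv.symm l)
  have hL : ∀ l, n (G.ofLeft l) = n₁ l := fun l => by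
    simp only [n]
    rw [show G.ofLeft l = G.linkEquiv (Sum.inl l) from rfl, Equiv.symm_apply_apply]
    rfl
  have hR : ∀ l, n (G.ofRight l) = n₂ l := fun l => by
    simp only [n]
    rw [show G.ofRight l = G.linkEquiv (Sum.inr l) from rfl, Equiv.symm_apply_apply]
    rfl
  refine ⟨n, funext fun l => ?_, funext fun l => by rw [rightSpins_eq, hR]⟩
  by_cases hl : (C₁.src l).1 = G.t₁
  · rw [G.eq_outLink l hl, leftSpins_outLink, hR, ← link_t₂, ← h, link_t₁]
  · exact (G.leftSpins_of_ne n ⟨l, hl⟩).trans (hL ⟨l, hl⟩)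

/-! ### Weights of the glued spin networks -/

theorem nodeDegree_inl (n : G.union.Link → ℕ) (t : {t // t ≠ G.t₁}) :
    G.union.nodeDegree n (Sum.inl t) = C₁.nodeDegree (G.leftSpins n) t := by
  simp [CellBoundary.nodeDegree, leftSpins_link]

theorem nodeDegree_inr (n : G.union.Link → ℕ) (t : {t // t ≠ G.t₂}) :
    G.union.nodeDegree n (Sum.inr t) = C₂.nodeDegree (G.rightSpins n) t := by
  simp [CellBoundary.nodeDegree, rightSpins_link]

/-- The sum `2J` of `2j` over the three glued sides. -/
def gluedDegree (n : G.union.Link → ℕ) : ℕ := ∑ i, G.leftSpins n (C₁.link (G.t₁, i))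

theorem nodeDegree_t₂ (n : G.union.Link → ℕ) :
    C₂.nodeDegree (G.rightSpins n) G.t₂ = G.gluedDegree n := by
  rw [CellBoundary.nodeDegree, gluedDegree, ← Equiv.sum_comp G.sides]
  simp only [rightSpins_link_t₂]

theorem prod_node {T M : Type*} [Fintype T] [DecidableEq T] [CommMonoid M] (t₀ : T) (f : T → M) :
    ∏ t, f t = f t₀ * ∏ t : {t // t ≠ t₀}, f t := by
  rw [← Fintype.prod_subtype_mul_prod_subtype (fun t => t = t₀) f]
  congr 1
  convert Fintype.prod_subsingleton (fun t : {t // t = t₀} => f t) ⟨t₀, rfl⟩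

/-- The coefficient of the edge amplitude cancels the two factors `(J + 1)!` of the glued triangles,
and one of the two factors `1 / (2 j)!` of every glued link is cancelled by Gaussian integration. -/
theorem weight_mul_weight [Fintype T₁] [Fintype T₂] (n : G.union.Link → ℕ)
    (hK : Even (G.gluedDegree n)) :
    C₁.weight (G.leftSpins n) * C₂.weight (G.rightSpins n) *
      ((edgeCoeff (G.gluedDegree n) : ℂ) * ((G.gluedDegree n)! : ℂ) *
        ∏ i, ((G.leftSpins n (C₁.link (G.t₁, i)))! : ℂ)) = G.union.weight n := by
  have hf : ∀ m : ℕ, (m ! : ℂ) ≠ 0 := fun m => by exact_mod_cast (Nat.factorial_pos m).ne'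
  simp only [CellBoundary.weight]
  rw [prod_node G.t₁ (fun t => (C₁.nodeDegree (G.leftSpins n) t / 2 + 1)!),
    prod_node G.t₂ (fun t => (C₂.nodeDegree (G.rightSpins n) t / 2 + 1)!), nodeDegree_t₂,
    show C₁.nodeDegree (G.leftSpins n) G.t₁ = G.gluedDegree n from rfl,
    Fintype.prod_sum_type, G.prod_link_left, G.prod_link_union]
  simp only [nodeDegree_inl, nodeDegree_inr, ← leftSpins_of_ne, ← rightSpins_eq, link_t₁,
    edgeCoeff, if_pos hK]
  push_cast
  have h1 := hf (G.gluedDegree n)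
  have h2 := hf (G.gluedDegree n / 2 + 1)
  have h3 : (∏ i, ((G.leftSpins n (G.outLink i))! : ℂ)) ≠ 0 :=
    Finset.prod_ne_zero_iff.2 fun i _ => hf _
  field_simp

end TypeIGluing

/-! ### Gluing the spin network integrands -/

namespace TypeIGluing

variable {T₁ T₂ : Type*} {C₁ : CellBoundary T₁} {C₂ : CellBoundary T₂} (G : TypeIGluing C₁ C₂)
  [DecidableEq T₁] [DecidableEq T₂]

theorem leftSpinors_of_ne (ζ : G.Triangles × Fin 3 → Spinor) (z : Fin 3 → Spinor)
    {h : T₁ × Fin 3} (hh : h.1 ≠ G.t₁) : G.leftSpinors ζ z h = ζ (G.left h hh) := dif_pos hh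

theorem leftSpinors_t₁ (ζ : G.Triangles × Fin 3 → Spinor) (z : Fin 3 → Spinor) (i : Fin 3) :
    G.leftSpinors ζ z (G.t₁, i) = z i := dif_neg (not_not.2 rfl)

theorem rightSpinors_of_ne (ζ : G.Triangles × Fin 3 → Spinor) (w : Fin 3 → Spinor)
    {h : T₂ × Fin 3} (hh : h.1 ≠ G.t₂) : G.rightSpinors ζ w h = ζ (G.right h hh) := dif_pos hh

theorem rightSpinors_t₂ (ζ : G.Triangles × Fin 3 → Spinor) (w : Fin 3 → Spinor) (i : Fin 3) :
    G.rightSpinors ζ w (G.t₂, i) = w i := dif_neg (not_not.2 rfl)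

theorem continuous_leftSpinors (ζ : G.Triangles × Fin 3 → Spinor) :
    Continuous (G.leftSpinors ζ) := by
  refine continuous_pi fun h => ?_
  unfold leftSpinors
  split_ifs <;> fun_prop

theorem continuous_rightSpinors (ζ : G.Triangles × Fin 3 → Spinor) :
    Continuous (G.rightSpinors ζ) := by
  refine continuous_pi fun h => ?_
  unfold rightSpinors
  split_ifs <;> fun_prop

variable [Fintype T₁] [Fintype T₂]

/-- The factors of the first spin network integrand that do not involve the glued triangle. -/
def leftRest (n₁ : C₁.Link → ℕ) (ζ : G.Triangles × Fin 3 → Spinor) (h : T₁ → SU2) : ℂ :=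
  ∏ l : G.LeftLink, coherentElement (n₁ l.1) (ζ (G.left (C₁.tgt l.1) (G.tgt_ne _)))
    ((h (C₁.tgt l.1).1)⁻¹ * 1 * h (C₁.src l.1).1) (ζ (G.left (C₁.src l.1) l.2))

/-- The linear form in the spinor on side `i` of the first glued triangle whose power occurs in the
first spin network integrand. -/
def leftForm (ζ : G.Triangles × Fin 3 → Spinor) (h : T₁ → SU2) (i : Fin 3) : Spinor :=
  SU2.rowForm (ζ (G.left (C₁.tgt (G.outLink i)) (G.tgt_ne _)))
    ((h (C₁.tgt (G.outLink i)).1)⁻¹ * 1 * h G.t₁)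

/-- The factors of the second spin network integrand that do not involve the glued triangle. -/
def rightRest (n₂ : C₂.Link → ℕ) (ζ : G.Triangles × Fin 3 → Spinor) (h : T₂ → SU2) : ℂ :=
  ∏ l : G.RightLink, coherentElement (n₂ l.1) (ζ (G.right (C₂.tgt l.1) l.2))
    ((h (C₂.tgt l.1).1)⁻¹ * 1 * h (C₂.src l.1).1) (ζ (G.right (C₂.src l.1) (G.src_ne _)))

/-- The linear form in the spinor on side `i` of the second glued triangle whose power occurs in
the second spin network integrand. -/
def rightForm (ζ : G.Triangles × Fin 3 → Spinor) (h : T₂ → SU2) (i : Fin 3) : Spinor :=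
  (((h G.t₂)⁻¹ * 1 * h (C₂.src (G.inLink i)).1).act
    (ζ (G.right (C₂.src (G.inLink i)) (G.src_ne _)))).flip

theorem networkIntegrand_left (n₁ : C₁.Link → ℕ) (ζ : G.Triangles × Fin 3 → Spinor)
    (z : Fin 3 → Spinor) (h : T₁ → SU2) :
    C₁.networkIntegrand n₁ (G.leftSpinors ζ z) h =
      G.leftRest n₁ ζ h * ∏ i, (G.leftForm ζ h i ⬝ᵥ z i) ^ n₁ (C₁.link (G.t₁, i)) := by
  rw [CellBoundary.networkIntegrand, G.prod_link_left, mul_comm]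
  congr 1
  · refine Finset.prod_congr rfl fun l _ => ?_
    rw [G.leftSpinors_of_ne ζ z (G.tgt_ne l.1), G.leftSpinors_of_ne ζ z l.2]
  · refine Finset.prod_congr rfl fun i _ => ?_
    rw [coherentElement_eq_rowForm, G.leftSpinors_of_ne ζ z (G.tgt_ne _), link_t₁,
      show C₁.src (G.outLink i) = (G.t₁, i) from rfl, leftSpinors_t₁]
    rfl

theorem networkIntegrand_right (n₂ : C₂.Link → ℕ) (ζ : G.Triangles × Fin 3 → Spinor)
    (w : Fin 3 → Spinor) (h : T₂ → SU2) :
    C₂.networkIntegrand n₂ (G.rightSpinors ζ w) h =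
      G.rightRest n₂ ζ h * ∏ i, (G.rightForm ζ h i ⬝ᵥ w i) ^ n₂ (C₂.link (G.t₂, i)) := by
  rw [CellBoundary.networkIntegrand, G.prod_link_right, mul_comm]
  congr 1
  · refine Finset.prod_congr rfl fun l _ => ?_
    rw [G.rightSpinors_of_ne ζ w (G.src_ne l.1), G.rightSpinors_of_ne ζ w l.2]
  · refine Finset.prod_congr rfl fun i _ => ?_
    rw [coherentElement_eq_flip, G.rightSpinors_of_ne ζ w (G.src_ne _), link_t₂, tgt_inLink,
      rightSpinors_t₂]
    rfl

/-- The configuration on the union that is obtained from configurations on both boundaries by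
gauge transformations that move the group elements of the glued triangles to the identity. -/
def gaugeFix (x : (T₁ → SU2) × (T₂ → SU2)) : G.Triangles → SU2 :=
  Sum.elim (fun t => (x.1 G.t₁)⁻¹ * x.1 t.1) fun t => (x.2 G.t₂)⁻¹ * x.2 t.1

theorem measurePreserving_gaugeFix :
    MeasurePreserving G.gaugeFix ((gaugeMeasure T₁).prod (gaugeMeasure T₂))
      (gaugeMeasure G.Triangles) := by
  have hprod := (_root_.measurePreserving_gaugeFix G.t₁).prod
    (_root_.measurePreserving_gaugeFix G.t₂)
  have hsum := measurePreserving_sumPiEquivProdPi_symm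
    (fun _ : {t : T₁ // t ≠ G.t₁} ⊕ {t : T₂ // t ≠ G.t₂} => haarSU2)
  have hcomp := hsum.comp hprod
  convert hcomp using 1
  funext x t
  rcases t with t | t <;> rfl

theorem networkIntegrand_union_gaugeFix (n : G.union.Link → ℕ)
    (ζ : G.Triangles × Fin 3 → Spinor) (x : (T₁ → SU2) × (T₂ → SU2)) :
    G.union.networkIntegrand n ζ (G.gaugeFix x) =
      G.leftRest (G.leftSpins n) ζ x.1 * (∏ i, (G.rightForm ζ x.2 (G.sides i) ⬝ᵥ
        (G.leftForm ζ x.1 i).flip) ^ G.leftSpins n (C₁.link (G.t₁, i))) *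
          G.rightRest (G.rightSpins n) ζ x.2 := by
  rw [CellBoundary.networkIntegrand, G.prod_link_union, G.prod_link_right, mul_assoc]
  congr 1
  · refine Finset.prod_congr rfl fun l _ => ?_
    rw [leftSpins_of_ne, tgt_ofLeft]
    change coherentElement _ _ (((x.1 G.t₁)⁻¹ * x.1 (C₁.tgt l.1).1)⁻¹ * 1 *
      ((x.1 G.t₁)⁻¹ * x.1 (C₁.src l.1).1)) _ = _
    congr 1
    group
  congr 1
  · rw [← Equiv.prod_comp G.sides]
    refine Finset.prod_congr rfl fun i _ => ?_
    rw [link_t₁, leftSpins_outLink, tgt_ofRight_inLink]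
    simp only [leftForm, rightForm]
    rw [flip_dotProduct_flip, SU2.rowForm_dotProduct_act, ← coherentElement_eq_rowForm]
    change coherentElement _ _ (((x.1 G.t₁)⁻¹ * x.1 (C₁.tgt (G.outLink i)).1)⁻¹ * 1 *
      ((x.2 G.t₂)⁻¹ * x.2 (C₂.src (G.inLink (G.sides i))).1)) _ = _
    rw [show ((x.1 G.t₁)⁻¹ * x.1 (C₁.tgt (G.outLink i)).1)⁻¹ * 1 *
      ((x.2 G.t₂)⁻¹ * x.2 (C₂.src (G.inLink (G.sides i))).1) =
      (x.1 (C₁.tgt (G.outLink i)).1)⁻¹ * 1 * x.1 G.t₁ *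
        ((x.2 G.t₂)⁻¹ * 1 * x.2 (C₂.src (G.inLink (G.sides i))).1) by group]
    rfl
  · refine Finset.prod_congr rfl fun l _ => ?_
    rw [rightSpins_eq, tgt_ofRight]
    change coherentElement _ _ (((x.2 G.t₂)⁻¹ * x.2 (C₂.tgt l.1).1)⁻¹ * 1 *
      ((x.2 G.t₂)⁻¹ * x.2 (C₂.src l.1).1)) _ = _
    congr 1
    group

theorem integral_networkIntegrand_union (n : G.union.Link → ℕ)
    (ζ : G.Triangles × Fin 3 → Spinor) :
    ∫ h, G.union.networkIntegrand n ζ h ∂gaugeMeasure G.Triangles =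
      ∫ x, G.union.networkIntegrand n ζ (G.gaugeFix x)
        ∂(gaugeMeasure T₁).prod (gaugeMeasure T₂) := by
  have hc : Continuous (G.union.networkIntegrand n ζ) :=
    (G.union.continuous_networkIntegrand n).comp
      (f := fun h : G.Triangles → SU2 => (ζ, h)) (by fun_prop)
  have hmp := G.measurePreserving_gaugeFix
  rw [← hmp.map_eq]
  refine integral_map hmp.aemeasurable ?_
  rw [hmp.map_eq]
  exact hc.aestronglyMeasurable

/-- The spin network of the union vanishes if the spins of the glued sides have a half-integral
sum: changing the sign of the group element of the first glued triangle changes the sign of the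
integrand. -/
theorem integral_networkIntegrand_union_of_odd (n : G.union.Link → ℕ)
    (ζ : G.Triangles × Fin 3 → Spinor) (hK : Odd (G.gluedDegree n)) :
    ∫ h, G.union.networkIntegrand n ζ h ∂gaugeMeasure G.Triangles = 0 := by
  let s : (T₁ → SU2) × (T₂ → SU2) := (Pi.mulSingle G.t₁ SU2.negOne, 1)
  have hs : ∀ (h : T₁ → SU2) t, t ≠ G.t₁ → (s.1 * h) t = h t := fun h t ht => by
    simp [s, Pi.mulSingle_eq_of_ne ht]
  have hflip : ∀ x, G.union.networkIntegrand n ζ (G.gaugeFix (s * x)) =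
      -G.union.networkIntegrand n ζ (G.gaugeFix x) := fun x => by
    have hrest : G.leftRest (G.leftSpins n) ζ (s.1 * x.1) = G.leftRest (G.leftSpins n) ζ x.1 :=
      Finset.prod_congr rfl fun l _ => by rw [hs _ _ (G.tgt_ne l.1), hs _ _ l.2]
    have hform : ∀ i, (G.leftForm ζ (s.1 * x.1) i).flip = -(G.leftForm ζ x.1 i).flip := fun i => by
      simp only [leftForm]
      rw [hs _ _ (G.tgt_ne _), Pi.mul_apply, show s.1 G.t₁ = SU2.negOne by simp [s],
        SU2.rowForm_mul_negOne_mul]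
      simp [Spinor.flip]
    rw [networkIntegrand_union_gaugeFix, networkIntegrand_union_gaugeFix, Prod.fst_mul,
      Prod.snd_mul, hrest, show s.2 * x.2 = x.2 from one_mul _]
    simp only [hform, dotProduct_neg]
    simp only [neg_pow (_ ⬝ᵥ _), Finset.prod_mul_distrib, Finset.prod_pow_eq_pow_sum]
    rw [show ∑ i, G.leftSpins n (C₁.link (G.t₁, i)) = G.gluedDegree n from rfl, hK.neg_one_pow]
    ring
  rw [integral_networkIntegrand_union]
  have : ((gaugeMeasure T₁).prod (gaugeMeasure T₂)).IsMulLeftInvariant :=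
    Measure.prod.instIsMulLeftInvariant
  have h := integral_mul_left_eq_self (μ := (gaugeMeasure T₁).prod (gaugeMeasure T₂))
    (fun x => G.union.networkIntegrand n ζ (G.gaugeFix x)) s
  simp only [hflip, integral_neg] at h
  exact self_eq_neg.1 h.symm

end TypeIGluing

/-! ### The gluing integral -/

namespace TypeIGluing

variable {T₁ T₂ : Type*} {C₁ : CellBoundary T₁} {C₂ : CellBoundary T₂} (G : TypeIGluing C₁ C₂)
  [DecidableEq T₁] [DecidableEq T₂] [Fintype T₁] [Fintype T₂]

theorem norm_leftSpinors_le {ζ : G.Triangles × Fin 3 → Spinor} {r : ℝ} (hζ : ∀ h, ‖ζ h‖ ≤ r)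
    (z : Fin 3 → Spinor) (h : T₁ × Fin 3) (hh : h.1 ≠ G.t₁) : ‖G.leftSpinors ζ z h‖ ≤ r := by
  rw [G.leftSpinors_of_ne ζ z hh]
  exact hζ _

theorem norm_rightSpinors_le {ζ : G.Triangles × Fin 3 → Spinor} {r : ℝ} (hζ : ∀ h, ‖ζ h‖ ≤ r)
    (w : Fin 3 → Spinor) (h : T₂ × Fin 3) (hh : h.1 ≠ G.t₂) : ‖G.rightSpinors ζ w h‖ ≤ r := by
  rw [G.rightSpinors_of_ne ζ w hh]
  exact hζ _

theorem prod_norm_div_pow {r : ℝ} (z : Fin 3 → Spinor) (k : Fin 3 → ℕ) :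
    ∏ i, (‖z i‖ / r) ^ k i = (∏ i, r⁻¹ ^ k i) * ∏ i, ‖z i‖ ^ k i := by
  rw [← Finset.prod_mul_distrib]
  exact Finset.prod_congr rfl fun i _ => by rw [← mul_pow, div_eq_inv_mul]

theorem norm_networkIntegrand_left_le (n₁ : C₁.Link → ℕ) {ζ : G.Triangles × Fin 3 → Spinor}
    {r : ℝ} (hr : 0 < r) (hζ : ∀ h, ‖ζ h‖ ≤ r) (z : Fin 3 → Spinor) (h : T₁ → SU2) :
    ‖C₁.networkIntegrand n₁ (G.leftSpinors ζ z) h‖ ≤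
      ((2 * r) ^ 2) ^ (∑ l, n₁ l) * (∏ i, r⁻¹ ^ n₁ (C₁.link (G.t₁, i))) *
        ∏ i, ‖z i‖ ^ n₁ (C₁.link (G.t₁, i)) := by
  have hle := C₁.prod_mul_norm_pow_le n₁ (G.leftSpinors ζ z) G.t₁ two_pos.le hr
    (G.norm_leftSpinors_le hζ z)
  simp only [leftSpinors_t₁, prod_norm_div_pow, ← mul_assoc] at hle
  exact (C₁.norm_networkIntegrand_le _ _ h).trans hle

theorem norm_networkIntegrand_right_le (n₂ : C₂.Link → ℕ) {ζ : G.Triangles × Fin 3 → Spinor}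
    {r : ℝ} (hr : 0 < r) (hζ : ∀ h, ‖ζ h‖ ≤ r) (w : Fin 3 → Spinor) (h : T₂ → SU2) :
    ‖C₂.networkIntegrand n₂ (G.rightSpinors ζ w) h‖ ≤
      ((2 * r) ^ 2) ^ (∑ l, n₂ l) * (∏ i, r⁻¹ ^ n₂ (C₂.link (G.t₂, i))) *
        ∏ i, ‖w i‖ ^ n₂ (C₂.link (G.t₂, i)) := by
  have hle := C₂.prod_mul_norm_pow_le n₂ (G.rightSpinors ζ w) G.t₂ two_pos.le hr
    (G.norm_rightSpinors_le hζ w)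
  simp only [rightSpinors_t₂, prod_norm_div_pow, ← mul_assoc] at hle
  exact (C₂.norm_networkIntegrand_le _ _ h).trans hle

/-- The integrand of the gluing integral before integration over the gauge group. -/
def jointIntegrand (n₁ : C₁.Link → ℕ) (n₂ : C₂.Link → ℕ) (ζ : G.Triangles × Fin 3 → Spinor)
    (x : (T₁ → SU2) × (T₂ → SU2)) (p : (Fin 3 → Spinor) × (Fin 3 → Spinor)) : ℂ :=
  C₁.networkIntegrand n₁ (G.leftSpinors ζ p.1) x.1 * edgeAmplitude G.sides p.1 p.2 *
    C₂.networkIntegrand n₂ (G.rightSpinors ζ p.2) x.2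

theorem gluingIntegrand_eq_integral (n₁ : C₁.Link → ℕ) (n₂ : C₂.Link → ℕ)
    (ζ : G.Triangles × Fin 3 → Spinor) (p : (Fin 3 → Spinor) × (Fin 3 → Spinor)) :
    G.gluingIntegrand n₁ n₂ ζ p = C₁.weight n₁ * C₂.weight n₂ *
      ∫ x, G.jointIntegrand n₁ n₂ ζ x p ∂(gaugeMeasure T₁).prod (gaugeMeasure T₂) := by
  have h : ∀ x, G.jointIntegrand n₁ n₂ ζ x p =
      edgeAmplitude G.sides p.1 p.2 * (C₁.networkIntegrand n₁ (G.leftSpinors ζ p.1) x.1 *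
        C₂.networkIntegrand n₂ (G.rightSpinors ζ p.2) x.2) := fun x => by
    rw [jointIntegrand]
    ring
  simp only [h]
  rw [integral_const_mul,
    integral_prod_mul (fun h => C₁.networkIntegrand n₁ (G.leftSpinors ζ p.1) h)
    (fun h => C₂.networkIntegrand n₂ (G.rightSpinors ζ p.2) h), gluingIntegrand,
    CellBoundary.scalelessTerm_eq, CellBoundary.scalelessTerm_eq]
  ring

theorem continuous_networkIntegrand_left (n₁ : C₁.Link → ℕ) (ζ : G.Triangles × Fin 3 → Spinor) :
    Continuous fun q : ((T₁ → SU2) × (T₂ → SU2)) × ((Fin 3 → Spinor) × (Fin 3 → Spinor)) =>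
      C₁.networkIntegrand n₁ (G.leftSpinors ζ q.2.1) q.1.1 :=
  (C₁.continuous_networkIntegrand n₁).comp
    (f := fun q : ((T₁ → SU2) × (T₂ → SU2)) × ((Fin 3 → Spinor) × (Fin 3 → Spinor)) =>
      (G.leftSpinors ζ q.2.1, q.1.1))
    (((G.continuous_leftSpinors ζ).comp (continuous_fst.comp continuous_snd)).prodMk (by fun_prop))

theorem continuous_networkIntegrand_right (n₂ : C₂.Link → ℕ) (ζ : G.Triangles × Fin 3 → Spinor) :
    Continuous fun q : ((T₁ → SU2) × (T₂ → SU2)) × ((Fin 3 → Spinor) × (Fin 3 → Spinor)) =>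
      C₂.networkIntegrand n₂ (G.rightSpinors ζ q.2.2) q.1.2 :=
  (C₂.continuous_networkIntegrand n₂).comp
    (f := fun q : ((T₁ → SU2) × (T₂ → SU2)) × ((Fin 3 → Spinor) × (Fin 3 → Spinor)) =>
      (G.rightSpinors ζ q.2.2, q.1.2))
    (((G.continuous_rightSpinors ζ).comp (continuous_snd.comp continuous_snd)).prodMk (by fun_prop))

/-- Joint integrability in the group elements and the spinors, which lets Gaussian and Haar
integration be interchanged. -/
theorem integrable_jointIntegrand (n₁ : C₁.Link → ℕ) (n₂ : C₂.Link → ℕ)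
    (ζ : G.Triangles × Fin 3 → Spinor) :
    Integrable (fun q : ((T₁ → SU2) × (T₂ → SU2)) × ((Fin 3 → Spinor) × (Fin 3 → Spinor)) =>
      G.jointIntegrand n₁ n₂ ζ q.1 q.2)
      (((gaugeMeasure T₁).prod (gaugeMeasure T₂)).prod gluingMeasure) := by
  have hr : 0 < ‖ζ‖ + 1 := by positivity
  have hζ : ∀ h, ‖ζ h‖ ≤ ‖ζ‖ + 1 := fun h => (norm_le_pi_norm ζ h).trans (by simp)
  have hbound := fun q : ((T₁ → SU2) × (T₂ → SU2)) × ((Fin 3 → Spinor) × (Fin 3 → Spinor)) =>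
    norm_mul_edgeAmplitude_mul_le G.sides (by positivity) (by positivity)
      (G.norm_networkIntegrand_left_le n₁ hr hζ q.2.1 q.1.1)
      (G.norm_networkIntegrand_right_le n₂ hr hζ q.2.2 q.1.2)
  refine (((integrable_gluingBound _ _).comp_snd
    ((gaugeMeasure T₁).prod (gaugeMeasure T₂))).const_mul _).mono' ?_ (.of_forall hbound)
  exact (((G.continuous_networkIntegrand_left n₁ ζ).aestronglyMeasurable).mul
    ((stronglyMeasurable_edgeAmplitude G.sides).comp_measurable
      measurable_snd).aestronglyMeasurable).mul
    (G.continuous_networkIntegrand_right n₂ ζ).aestronglyMeasurable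

theorem integrable_gluingIntegrand (n₁ : C₁.Link → ℕ) (n₂ : C₂.Link → ℕ)
    (ζ : G.Triangles × Fin 3 → Spinor) : Integrable (G.gluingIntegrand n₁ n₂ ζ) gluingMeasure := by
  rw [funext (G.gluingIntegrand_eq_integral n₁ n₂ ζ)]
  exact (G.integrable_jointIntegrand n₁ n₂ ζ).integral_prod_right.const_mul _

theorem integral_jointIntegrand (n₁ : C₁.Link → ℕ) (n₂ : C₂.Link → ℕ)
    (ζ : G.Triangles × Fin 3 → Spinor) (x : (T₁ → SU2) × (T₂ → SU2)) :
    ∫ p, G.jointIntegrand n₁ n₂ ζ x p ∂gluingMeasure =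
      G.leftRest n₁ ζ x.1 * G.rightRest n₂ ζ x.2 *
        ((edgeCoeff (∑ i, n₁ (C₁.link (G.t₁, i))) : ℂ) *
          ((∑ i, n₁ (C₁.link (G.t₁, i)))! : ℂ) *
          ∏ i, if n₂ (C₂.link (G.t₂, G.sides i)) = n₁ (C₁.link (G.t₁, i)) then
            ((n₁ (C₁.link (G.t₁, i)))! : ℂ) *
              (G.rightForm ζ x.2 (G.sides i) ⬝ᵥ (G.leftForm ζ x.1 i).flip) ^ n₁ (C₁.link (G.t₁, i))
            else 0) := by
  rw [← integral_prod_mul_edgeAmplitude_mul G.sides (G.leftForm ζ x.1) (G.rightForm ζ x.2)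
    (fun i => n₁ (C₁.link (G.t₁, i))) (fun i => n₂ (C₂.link (G.t₂, i))), ← integral_const_mul]
  congr 1 with p
  rw [jointIntegrand, networkIntegrand_left, networkIntegrand_right]
  ring

theorem integral_gluingIntegrand (n₁ : C₁.Link → ℕ) (n₂ : C₂.Link → ℕ)
    (ζ : G.Triangles × Fin 3 → Spinor) :
    ∫ p, G.gluingIntegrand n₁ n₂ ζ p ∂gluingMeasure = C₁.weight n₁ * C₂.weight n₂ *
      ∫ x, (∫ p, G.jointIntegrand n₁ n₂ ζ x p ∂gluingMeasure)
        ∂(gaugeMeasure T₁).prod (gaugeMeasure T₂) := by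
  simp only [gluingIntegrand_eq_integral, integral_const_mul]
  rw [← integral_integral_swap (G.integrable_jointIntegrand n₁ n₂ ζ)]

theorem integral_gluingIntegrand_of_ne {n₁ : C₁.Link → ℕ} {n₂ : C₂.Link → ℕ}
    (ζ : G.Triangles × Fin 3 → Spinor)
    (h : ∃ i, n₁ (C₁.link (G.t₁, i)) ≠ n₂ (C₂.link (G.t₂, G.sides i))) :
    ∫ p, G.gluingIntegrand n₁ n₂ ζ p ∂gluingMeasure = 0 := by
  obtain ⟨i, hi⟩ := h
  rw [integral_gluingIntegrand]
  have hjoint : ∀ x, ∫ p, G.jointIntegrand n₁ n₂ ζ x p ∂gluingMeasure = 0 := fun x => by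
    rw [integral_jointIntegrand, Finset.prod_eq_zero (Finset.mem_univ i) (if_neg hi.symm), mul_zero,
      mul_zero]
  simp [hjoint]

/-- If the spins of the glued sides have a half-integral sum, both sides vanish, so that the rounding
in the weights does not matter. -/
theorem integral_gluingIntegrand_spins (n : G.union.Link → ℕ)
    (ζ : G.Triangles × Fin 3 → Spinor) :
    ∫ p, G.gluingIntegrand (G.leftSpins n) (G.rightSpins n) ζ p ∂gluingMeasure =
      G.union.scalelessTerm n ζ := by
  have hjoint : ∀ x, ∫ p, G.jointIntegrand (G.leftSpins n) (G.rightSpins n) ζ x p ∂gluingMeasure =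
      (edgeCoeff (G.gluedDegree n) : ℂ) * ((G.gluedDegree n)! : ℂ) *
        (∏ i, ((G.leftSpins n (C₁.link (G.t₁, i)))! : ℂ)) *
          G.union.networkIntegrand n ζ (G.gaugeFix x) := fun x => by
    rw [integral_jointIntegrand, networkIntegrand_union_gaugeFix]
    simp only [rightSpins_link_t₂, if_true, Finset.prod_mul_distrib, gluedDegree]
    ring
  rw [integral_gluingIntegrand, CellBoundary.scalelessTerm_eq]
  simp only [hjoint, integral_const_mul]
  rw [← integral_networkIntegrand_union]
  rcases Nat.even_or_odd (G.gluedDegree n) with hK | hK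
  · rw [← G.weight_mul_weight n hK, mul_assoc]
    ring
  · rw [G.integral_networkIntegrand_union_of_odd n ζ hK]
    simp

theorem hasSum_integral_gluingIntegrand {ζ : G.Triangles × Fin 3 → Spinor}
    (hζ : G.union.ConvergesAt ζ) :
    HasSum (fun n : (C₁.Link → ℕ) × (C₂.Link → ℕ) =>
      ∫ p, G.gluingIntegrand n.1 n.2 ζ p ∂gluingMeasure) (G.union.scalelessEvaluation ζ) := by
  refine (G.injective_leftSpins_rightSpins.hasSum_iff fun n hn => ?_).1 ?_
  · refine G.integral_gluingIntegrand_of_ne ζ ?_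
    by_contra! h
    obtain ⟨m, h1, h2⟩ := G.exists_leftSpins_rightSpins h
    exact hn ⟨m, Prod.ext h1 h2⟩
  · refine (Summable.hasSum hζ).congr_fun fun n => ?_
    exact G.integral_gluingIntegrand_spins n ζ

/-! ### Homogeneous parts -/

/-- A bound for the terms of a homogeneous part of degrees `k`, up to the factor `∏ᵢ ‖z i‖ ^ k i`,
when all spinors that are not integrated over have norm at most `1 / 14`. -/
def partBound {T : Type*} [Fintype T] (C : CellBoundary T) (k : Fin 3 → ℕ) (n : C.Link → ℕ) : ℝ :=
  2 ^ Fintype.card T * (1 / 4) ^ (∑ l, n l) * ∏ i, 14 ^ k i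

theorem partBound_nonneg {T : Type*} [Fintype T] (C : CellBoundary T) (k : Fin 3 → ℕ)
    (n : C.Link → ℕ) : 0 ≤ partBound C k n := by
  unfold partBound
  positivity

theorem summable_partBound {T : Type*} [Fintype T] (C : CellBoundary T) (k : Fin 3 → ℕ) :
    Summable (partBound C k) :=
  ((summable_pow_sum (by norm_num) (by norm_num)).mul_left _).mul_right _

variable {G} {ζ : G.Triangles × Fin 3 → Spinor} {k k₁ k₂ : Fin 3 → ℕ}

theorem norm_scalelessTerm_left_le (hζ : ∀ h, ‖ζ h‖ ≤ 1 / 14)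
    (n : {n : C₁.Link → ℕ // ∀ i, n (C₁.link (G.t₁, i)) = k i}) (z : Fin 3 → Spinor) :
    ‖C₁.scalelessTerm n.1 (G.leftSpinors ζ z)‖ ≤ partBound C₁ k n.1 * ∏ i, ‖z i‖ ^ k i := by
  have hle := C₁.prod_mul_norm_pow_le n.1 (G.leftSpinors ζ z) G.t₁ (c := 7) (by norm_num)
    (by norm_num) (G.norm_leftSpinors_le hζ z)
  simp only [leftSpinors_t₁, prod_norm_div_pow, n.2] at hle
  refine (C₁.norm_scalelessTerm_le _ _).trans
    ((mul_le_mul_of_nonneg_left hle (by positivity)).trans_eq ?_)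
  rw [partBound]
  norm_num
  ring

theorem norm_scalelessTerm_right_le (hζ : ∀ h, ‖ζ h‖ ≤ 1 / 14)
    (n : {n : C₂.Link → ℕ // ∀ i, n (C₂.link (G.t₂, i)) = k i}) (w : Fin 3 → Spinor) :
    ‖C₂.scalelessTerm n.1 (G.rightSpinors ζ w)‖ ≤ partBound C₂ k n.1 * ∏ i, ‖w i‖ ^ k i := by
  have hle := C₂.prod_mul_norm_pow_le n.1 (G.rightSpinors ζ w) G.t₂ (c := 7) (by norm_num)
    (by norm_num) (G.norm_rightSpinors_le hζ w)
  simp only [rightSpinors_t₂, prod_norm_div_pow, n.2] at hle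
  refine (C₂.norm_scalelessTerm_le _ _).trans
    ((mul_le_mul_of_nonneg_left hle (by positivity)).trans_eq ?_)
  rw [partBound]
  norm_num
  ring

theorem summable_left (hζ : ∀ h, ‖ζ h‖ ≤ 1 / 14) (k : Fin 3 → ℕ) (z : Fin 3 → Spinor) :
    Summable fun n : {n : C₁.Link → ℕ // ∀ i, n (C₁.link (G.t₁, i)) = k i} =>
      C₁.scalelessTerm n.1 (G.leftSpinors ζ z) :=
  .of_norm_bounded (((summable_partBound C₁ k).subtype _).mul_right _)
    fun n => norm_scalelessTerm_left_le hζ n z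

theorem summable_right (hζ : ∀ h, ‖ζ h‖ ≤ 1 / 14) (k : Fin 3 → ℕ) (w : Fin 3 → Spinor) :
    Summable fun n : {n : C₂.Link → ℕ // ∀ i, n (C₂.link (G.t₂, i)) = k i} =>
      C₂.scalelessTerm n.1 (G.rightSpinors ζ w) :=
  .of_norm_bounded (((summable_partBound C₂ k).subtype _).mul_right _)
    fun n => norm_scalelessTerm_right_le hζ n w

/-- The pairs of spin assignments that contribute to the product of the homogeneous parts of degrees
`k₁` and `k₂`. -/
abbrev PartIndex (G : TypeIGluing C₁ C₂) (k₁ k₂ : Fin 3 → ℕ) : Type _ :=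
  {n : C₁.Link → ℕ // ∀ i, n (C₁.link (G.t₁, i)) = k₁ i} ×
    {n : C₂.Link → ℕ // ∀ i, n (C₂.link (G.t₂, i)) = k₂ i}

theorem hasSum_gluingIntegrand (hζ : ∀ h, ‖ζ h‖ ≤ 1 / 14) (k₁ k₂ : Fin 3 → ℕ)
    (p : (Fin 3 → Spinor) × (Fin 3 → Spinor)) :
    HasSum (fun n : G.PartIndex k₁ k₂ => G.gluingIntegrand n.1.1 n.2.1 ζ p)
      (G.partIntegrand k₁ k₂ ζ p) := by
  let f : {n : C₁.Link → ℕ // ∀ i, n (C₁.link (G.t₁, i)) = k₁ i} → ℂ := fun n =>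
    C₁.scalelessTerm n.1 (G.leftSpinors ζ p.1) * edgeAmplitude G.sides p.1 p.2
  let g : {n : C₂.Link → ℕ // ∀ i, n (C₂.link (G.t₂, i)) = k₂ i} → ℂ := fun n =>
    C₂.scalelessTerm n.1 (G.rightSpinors ζ p.2)
  have hf : HasSum f (G.leftPart k₁ ζ p.1 * edgeAmplitude G.sides p.1 p.2) :=
    (summable_left hζ k₁ p.1).hasSum.mul_right _
  have hg : HasSum g (G.rightPart k₂ ζ p.2) := (summable_right hζ k₂ p.2).hasSum
  have hfg : Summable fun n : G.PartIndex k₁ k₂ => f n.1 * g n.2 :=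
    summable_mul_of_summable_norm hf.summable.norm hg.summable.norm
  have hmul := hf.mul hg hfg
  simp only [f, g] at hmul
  simp only [partIntegrand, gluingIntegrand]
  exact hmul

theorem norm_gluingIntegrand_le (hζ : ∀ h, ‖ζ h‖ ≤ 1 / 14) (n : G.PartIndex k₁ k₂)
    (p : (Fin 3 → Spinor) × (Fin 3 → Spinor)) :
    ‖G.gluingIntegrand n.1.1 n.2.1 ζ p‖ ≤
      partBound C₁ k₁ n.1.1 * partBound C₂ k₂ n.2.1 * gluingBound k₁ k₂ p :=
  norm_mul_edgeAmplitude_mul_le G.sides (partBound_nonneg _ _ _) (partBound_nonneg _ _ _)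
    (norm_scalelessTerm_left_le hζ n.1 p.1) (norm_scalelessTerm_right_le hζ n.2 p.2)

theorem summable_partBound_mul (G : TypeIGluing C₁ C₂) (k₁ k₂ : Fin 3 → ℕ) :
    Summable fun n : G.PartIndex k₁ k₂ => partBound C₁ k₁ n.1.1 * partBound C₂ k₂ n.2.1 :=
  ((summable_partBound C₁ k₁).subtype _).mul_of_nonneg ((summable_partBound C₂ k₂).subtype _)
    (fun _ => partBound_nonneg _ _ _) (fun _ => partBound_nonneg _ _ _)

theorem integrable_partIntegrand (hζ : ∀ h, ‖ζ h‖ ≤ 1 / 14) (k₁ k₂ : Fin 3 → ℕ) :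
    Integrable (G.partIntegrand k₁ k₂ ζ) gluingMeasure := by
  refine ((integrable_gluingBound k₁ k₂).const_mul (∑' n : G.PartIndex k₁ k₂,
    partBound C₁ k₁ n.1.1 * partBound C₂ k₂ n.2.1)).mono' ?_ (.of_forall fun p => ?_)
  · refine aestronglyMeasurable_of_tendsto_ae Filter.atTop
      (f := fun (s : Finset (G.PartIndex k₁ k₂)) p => ∑ n ∈ s, G.gluingIntegrand n.1.1 n.2.1 ζ p)
      (fun s => ?_) (.of_forall fun p => hasSum_gluingIntegrand hζ k₁ k₂ p)
    exact (integrable_finsetSum s fun n _ => G.integrable_gluingIntegrand n.1.1 n.2.1 ζ).1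
  · rw [← (hasSum_gluingIntegrand hζ k₁ k₂ p).tsum_eq]
    exact tsum_of_norm_bounded ((summable_partBound_mul G k₁ k₂).hasSum.mul_right _)
      fun n => norm_gluingIntegrand_le hζ n p

theorem hasSum_integral_partIndex (hζ : ∀ h, ‖ζ h‖ ≤ 1 / 14) (k₁ k₂ : Fin 3 → ℕ) :
    HasSum (fun n : G.PartIndex k₁ k₂ => ∫ p, G.gluingIntegrand n.1.1 n.2.1 ζ p ∂gluingMeasure)
      (∫ p, G.partIntegrand k₁ k₂ ζ p ∂gluingMeasure) := by
  refine hasSum_integral_of_dominated_convergence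
    (fun n p => partBound C₁ k₁ n.1.1 * partBound C₂ k₂ n.2.1 * gluingBound k₁ k₂ p)
    (fun n => (G.integrable_gluingIntegrand n.1.1 n.2.1 ζ).1)
    (fun n => .of_forall fun p => norm_gluingIntegrand_le hζ n p)
    (.of_forall fun p => (summable_partBound_mul G k₁ k₂).mul_right _) ?_
    (.of_forall fun p => hasSum_gluingIntegrand hζ k₁ k₂ p)
  simp only [tsum_mul_right]
  exact (integrable_gluingBound k₁ k₂).const_mul _

theorem hasSum_integral_partIntegrand (hζ : ∀ h, ‖ζ h‖ ≤ 1 / 14) (hconv : G.union.ConvergesAt ζ) :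
    HasSum (fun k : (Fin 3 → ℕ) × (Fin 3 → ℕ) =>
      ∫ p, G.partIntegrand k.1 k.2 ζ p ∂gluingMeasure) (G.union.scalelessEvaluation ζ) := by
  let deg : (C₁.Link → ℕ) × (C₂.Link → ℕ) → (Fin 3 → ℕ) × (Fin 3 → ℕ) := fun n =>
    (fun i => n.1 (C₁.link (G.t₁, i)), fun i => n.2 (C₂.link (G.t₂, i)))
  refine ((G.hasSum_integral_gluingIntegrand hconv).tsum_fiberwise deg).congr_fun fun k => ?_
  let e : G.PartIndex k.1 k.2 ≃ deg ⁻¹' {k} :=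
    { toFun := fun n => ⟨(n.1.1, n.2.1), Prod.ext (funext n.1.2) (funext n.2.2)⟩
      invFun := fun n => (⟨n.1.1, congrFun (congrArg Prod.fst n.2)⟩,
        ⟨n.1.2, congrFun (congrArg Prod.snd n.2)⟩)
      left_inv := fun _ => rfl
      right_inv := fun _ => rfl }
  rw [← (hasSum_integral_partIndex hζ k.1 k.2).tsum_eq]
  exact e.tsum_eq fun n : deg ⁻¹' {k} => ∫ p, G.gluingIntegrand n.1.1 n.1.2 ζ p ∂gluingMeasure

end TypeIGluing

end

theorem proposition3 {T₁ T₂ : Type*} [Fintype T₁] [Fintype T₂] [DecidableEq T₁] [DecidableEq T₂]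
    (C₁ : CellBoundary T₁) (C₂ : CellBoundary T₂) (G : TypeIGluing C₁ C₂) :
    (C₁.ConvergesNearZero ∧ C₂.ConvergesNearZero ∧ G.union.ConvergesNearZero) ∧
    (∀ (n₁ : C₁.Link → ℕ) (n₂ : C₂.Link → ℕ) (ζ : G.Triangles × Fin 3 → Spinor),
      Integrable (G.gluingIntegrand n₁ n₂ ζ) TypeIGluing.gluingMeasure) ∧
    (∀ (n : G.union.Link → ℕ) (ζ : G.Triangles × Fin 3 → Spinor),
      ∫ p, G.gluingIntegrand (G.leftSpins n) (G.rightSpins n) ζ p ∂TypeIGluing.gluingMeasure =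
        G.union.scalelessTerm n ζ) ∧
    (∀ (n₁ : C₁.Link → ℕ) (n₂ : C₂.Link → ℕ) (ζ : G.Triangles × Fin 3 → Spinor),
      (∃ i, n₁ (C₁.link (G.t₁, i)) ≠ n₂ (C₂.link (G.t₂, G.sides i))) →
      ∫ p, G.gluingIntegrand n₁ n₂ ζ p ∂TypeIGluing.gluingMeasure = 0) ∧
    (∀ ζ : G.Triangles × Fin 3 → Spinor, G.union.ConvergesAt ζ →
      HasSum (fun n : (C₁.Link → ℕ) × (C₂.Link → ℕ) =>
          ∫ p, G.gluingIntegrand n.1 n.2 ζ p ∂TypeIGluing.gluingMeasure)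
        (G.union.scalelessEvaluation ζ)) ∧
    (∃ r : ℝ, 0 < r ∧ ∀ ζ : G.Triangles × Fin 3 → Spinor, (∀ h A, ‖ζ h A‖ < r) →
      G.union.ConvergesAt ζ ∧
      (∀ (k : Fin 3 → ℕ) (z : Fin 3 → Spinor),
        Summable fun n : {n : C₁.Link → ℕ // ∀ i, n (C₁.link (G.t₁, i)) = k i} =>
          C₁.scalelessTerm n.1 (G.leftSpinors ζ z)) ∧
      (∀ (k : Fin 3 → ℕ) (w : Fin 3 → Spinor),
        Summable fun n : {n : C₂.Link → ℕ // ∀ i, n (C₂.link (G.t₂, i)) = k i} =>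
          C₂.scalelessTerm n.1 (G.rightSpinors ζ w)) ∧
      (∀ k₁ k₂ : Fin 3 → ℕ, Integrable (G.partIntegrand k₁ k₂ ζ) TypeIGluing.gluingMeasure) ∧
      HasSum (fun k : (Fin 3 → ℕ) × (Fin 3 → ℕ) =>
          ∫ p, G.partIntegrand k.1 k.2 ζ p ∂TypeIGluing.gluingMeasure)
        (G.union.scalelessEvaluation ζ)) := by
  obtain ⟨r, hr, hconv⟩ := G.union.convergesNearZero
  refine ⟨⟨C₁.convergesNearZero, C₂.convergesNearZero, G.union.convergesNearZero⟩,
    G.integrable_gluingIntegrand, G.integral_gluingIntegrand_spins,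
    fun _ _ ζ h => G.integral_gluingIntegrand_of_ne ζ h,
    fun _ hζ => G.hasSum_integral_gluingIntegrand hζ,
    min r (1 / 14), by positivity, fun ζ hζ => ?_⟩
  have hζ' : ∀ h, ‖ζ h‖ ≤ 1 / 14 := fun h =>
    (pi_norm_le_iff_of_nonneg (by norm_num)).2 fun A => ((hζ h A).trans_le (min_le_right _ _)).le
  have hc : G.union.ConvergesAt ζ := hconv ζ fun h A => (hζ h A).trans_le (min_le_left _ _)
  exact ⟨hc, TypeIGluing.summable_left hζ', TypeIGluing.summable_right hζ',
    TypeIGluing.integrable_partIntegrand hζ', TypeIGluing.hasSum_integral_partIntegrand hζ' hc⟩
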